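/- Let $R$ be a Banach ring, that is, a commutative ring with $1$ with a complete norm such that $|ab|\le C|a||b|$ for some constant $C$. Let $\mathrm{Ban}_R$ be the category of Banach $R$-modules (complete normed $R$-modules $M$ with $\|am\|\le C|a|\|m\|$ for some constant $C$) and bounded $R$-linear maps, with the completed projective tensor product $\widehat\otimes_R$, the internal Hom $\underline{\mathrm{Hom}}$ given by bounded $R$-linear maps with the operator norm, and $W^\vee=\underline{\mathrm{Hom}}(W,R)$; extend these to the ind-category $\mathrm{Ind}(\mathrm{Ban}_R)$ by $``\mathrm{colim}"V_i\,\widehat\otimes_R\,``\mathrm{colim}"W_j=``\mathrm{colim}"(V_i\widehat\otimes_R W_j)$ and $\underline{\mathrm{Hom}}(W,``\mathrm{colim}"V_i)=``\mathrm{colim}"\,\underline{\mathrm{Hom}}(W,V_i)$ for $W\in\mathrm{Ban}_R$. An object $V$ of $\mathrm{Ind}(\mathrm{Ban}_R)$ is *nuclear* if for every $W\in\mathrm{Ban}_R$ the natural morphism $W^\vee\widehat\otimes_R V\to\underline{\mathrm{Hom}}(W,V)$ is an isomorphism, and *flat* if $(-)\widehat\otimes_R V$ preserves strict monomorphisms,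 where a monomorphism $f$ is strict if $\mathrm{coim}(f)\to\mathrm{im}(f)$ is an isomorphism. For $\rho\in\mathbb R_{>0}^n$ let $R\{\frac{x_1}{\rho_1},\dots,\frac{x_n}{\rho_n}\}$ be the Banach module of power series $\sum_J a_Jx^J\in R[[x_1,\dots,x_n]]$ with norm $\sum_J|a_J|\rho^J<\infty$. For $\tau\in(0,\infty]^n$ put $$\mathcal O(D^n_{<\tau,R})=\lim_{\rho<\tau}R\{\tfrac{x_1}{\rho_1},\dots,\tfrac{x_n}{\rho_n}\},\qquad \mathcal O(\mathbb A^n_R)=\lim_{r\in\mathbb Z_{>0}}R\{\tfrac{x_1}{r},\dots,\tfrac{x_n}{r}\},$$ the limits of the restriction morphisms being taken in $\mathrm{Ind}(\mathrm{Ban}_R)$, where $\rho<\tau$ means $\rho_i<\tau_i$ for all $i$. Then for every $n\ge 0$ and every $r=(r_1,\dots,r_n)$ with real $r_i\ge 0$, the limit $\mathcal O(D^n_{<r^{-1},R})$ exists and is nuclear and flat in $\mathrm{Ind}(\mathrm{Ban}_R)$, where $r^{-1}=(r_1^{-1},\dots,r_n^{-1})$ and $0^{-1}=\infty$. Likewise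 the limit $\mathcal O(\mathbb A^n_R)$ exists and is nuclear and flat in $\mathrm{Ind}(\mathrm{Ban}_R)$. -/

import Mathlib

open CategoryTheory CategoryTheory.Limits
open scoped NNReal ENNReal TensorProduct

universe u v

/-- A Banach ring: a commutative unital ring with a complete norm such that `|ab| ≤ C |a| |b|` for
some constant `C`.  That `|a| = 0` only for `a = 0`, and the triangle inequality, are contained in
the requirement that `|a - b|` is a metric. -/
class BanachRing (R : Type u) extends Norm R, CommRing R, MetricSpace R, CompleteSpace R where
  dist_eq_norm_sub : ∀ a b : R, dist a b = ‖a - b‖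
  exists_norm_mul_le : ∃ C : ℝ, 0 < C ∧ ∀ a b : R, ‖a * b‖ ≤ C * ‖a‖ * ‖b‖

namespace BanachRing

instance instNormedAddCommGroup (R : Type u) [BanachRing R] : NormedAddCommGroup R where
  dist_eq a b := by
    rw [dist_comm, BanachRing.dist_eq_norm_sub, sub_eq_neg_add]

end BanachRing

/-- A Banach module over a Banach ring `R`. -/
structure BanMod (R : Type u) [BanachRing R] : Type (u + 1) where
  carrier : Type u
  [normedAddCommGroup : NormedAddCommGroup carrier]
  [module : Module R carrier]
  [completeSpace : CompleteSpace carrier]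
  exists_norm_smul_le : ∃ C : ℝ, 0 < C ∧ ∀ (a : R) (m : carrier), ‖a • m‖ ≤ C * ‖a‖ * ‖m‖

namespace BanMod

variable {R : Type u} [BanachRing R]

instance : CoeSort (BanMod R) (Type u) := ⟨BanMod.carrier⟩

attribute [instance] BanMod.normedAddCommGroup BanMod.module BanMod.completeSpace

/-- The additive group of bounded `R`-linear maps `M → N`; it carries the operator norm. -/
def linHom (M N : BanMod R) : AddSubgroup (NormedAddGroupHom M N) where
  carrier := {f | ∀ (a : R) (m : M), f (a • m) = a • f m}
  add_mem' hf hg a m := by simp [hf a m, hg a m]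
  zero_mem' a m := by simp
  neg_mem' hf a m := by simp [hf a m]

/-- A bounded `R`-linear map from an additive map with a bound. -/
def mkHom {M N : BanMod R} (f : M →ₗ[R] N) (h : ∃ C : ℝ, ∀ m, ‖f m‖ ≤ C * ‖m‖) : linHom M N :=
  ⟨{ toFun := f, map_add' := f.map_add, bound' := h }, fun a m => f.map_smul a m⟩

@[simp] lemma mkHom_apply {M N : BanMod R} (f : M →ₗ[R] N)
    (h : ∃ C : ℝ, ∀ m, ‖f m‖ ≤ C * ‖m‖) (m : M) : (mkHom f h).1 m = f m := rfl

/-- The `R`-linear map underlying a bounded `R`-linear map. -/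
def toLin {M N : BanMod R} (f : linHom M N) : M →ₗ[R] N where
  toFun := f.1
  map_add' := map_add f.1
  map_smul' := f.2

@[simp] lemma toLin_apply {M N : BanMod R} (f : linHom M N) (m : M) : toLin f m = f.1 m := rfl

noncomputable section

/-- The category `Ban_R` of Banach modules and bounded `R`-linear maps. -/
instance : Category.{u} (BanMod R) where
  Hom M N := linHom M N
  id M := ⟨NormedAddGroupHom.id M, fun _ _ => rfl⟩
  comp f g := ⟨g.1.comp f.1, fun a m => by simp [f.2 a m, g.2 a]⟩

/-- A morphism of `Ban_R` as an element of `linHom`. -/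
def hom {M N : BanMod R} (f : M ⟶ N) : linHom M N := f

lemma hom_ext {M N : BanMod R} {f g : M ⟶ N} (h : ∀ m, (hom f).1 m = (hom g).1 m) : f = g :=
  Subtype.ext (NormedAddGroupHom.ext h)

@[simp] lemma hom_id (M : BanMod R) (m : M) : (hom (𝟙 M)).1 m = m := rfl

@[simp] lemma hom_comp {M N P : BanMod R} (f : M ⟶ N) (g : N ⟶ P) (m : M) :
    (hom (f ≫ g)).1 m = (hom g).1 ((hom f).1 m) := rfl

instance : Preadditive (BanMod R) where
  homGroup M N := inferInstanceAs (AddCommGroup (linHom M N))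
  add_comp _ _ _ f f' g := hom_ext fun m => map_add g.1 (f.1 m) (f'.1 m)
  comp_add _ _ _ _ _ _ := rfl

@[simp] lemma hom_zero {M N : BanMod R} (m : M) : (hom (0 : M ⟶ N)).1 m = 0 := rfl

/-! ### Zero object, kernels and cokernels -/

/-- The zero module. -/
def zero (R : Type u) [BanachRing R] : BanMod R where
  carrier := PUnit
  exists_norm_smul_le := ⟨1, one_pos, fun a m => by simp⟩

lemma isZero_zero : IsZero (zero R) := by
  rw [IsZero.iff_id_eq_zero]
  exact hom_ext fun m => rfl

instance : HasZeroObject (BanMod R) := ⟨zero R, isZero_zero⟩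

/-- A closed submodule of a Banach module. -/
def ofClosed {M : BanMod R} (S : Submodule R M) (hS : IsClosed (S : Set M)) : BanMod R where
  carrier := S
  completeSpace := hS.completeSpace_coe
  exists_norm_smul_le := by
    obtain ⟨C, hC, h⟩ := M.exists_norm_smul_le
    exact ⟨C, hC, fun a m => h a m⟩

/-- The quotient of a Banach module by a closed submodule. -/
def quot {M : BanMod R} (S : Submodule R M) (hS : IsClosed (S : Set M)) : BanMod R where
  carrier := M ⧸ S
  normedAddCommGroup := Submodule.Quotient.normedAddCommGroup S (hS := hS)
  completeSpace := Submodule.Quotient.completeSpace S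
  exists_norm_smul_le := by
    obtain ⟨C, hC, h⟩ := M.exists_norm_smul_le
    refine ⟨C, hC, fun a q => ?_⟩
    refine le_of_forall_pos_le_add fun ε hε => ?_
    have hK : 0 < C * ‖a‖ + 1 := by positivity
    obtain ⟨m, rfl, hm⟩ := Submodule.Quotient.norm_mk_lt q (div_pos hε hK)
    have h1 : ‖a • (Submodule.Quotient.mk m : M ⧸ S)‖ ≤ ‖a • m‖ := by
      rw [← Submodule.Quotient.mk_smul]; exact Submodule.Quotient.norm_mk_le S _
    have h2 := mul_le_mul_of_nonneg_left hm.le (by positivity : 0 ≤ C * ‖a‖)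
    have h3 : C * ‖a‖ * (ε / (C * ‖a‖ + 1)) ≤ ε := by
      rw [mul_div_assoc', div_le_iff₀ hK]; nlinarith
    have := h a m
    linarith [mul_add (C * ‖a‖) ‖(Submodule.Quotient.mk m : M ⧸ S)‖ (ε / (C * ‖a‖ + 1))]

lemma isClosed_ker {M N : BanMod R} (f : M ⟶ N) :
    IsClosed (LinearMap.ker (toLin f) : Set M) := by
  have h : (LinearMap.ker (toLin f) : Set M) = (hom f).1 ⁻¹' {0} := by
    ext m; exact LinearMap.mem_ker
  rw [h]
  exact isClosed_singleton.preimage (hom f).1.continuous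

instance : HasKernels (BanMod R) where
  has_limit {M N} f := by
    let K : BanMod R := ofClosed (LinearMap.ker (toLin f)) (isClosed_ker f)
    let i : K ⟶ M := mkHom (N := M) (M := K) (LinearMap.ker (toLin f)).subtype
      ⟨1, fun m => by rw [one_mul]; exact le_rfl⟩
    have hi : i ≫ f = 0 := hom_ext fun m => m.2
    refine ⟨⟨⟨KernelFork.ofι i hi, KernelFork.IsLimit.ofι i hi
      (fun {W} g hg => mkHom (N := K) ((toLin g).codRestrict _ fun w => ?_) ?_) ?_ ?_⟩⟩⟩
    · exact congrArg (fun k => (hom k).1 w) hg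
    · exact (hom g).1.bound.imp fun C h => h.2
    · intro W g hg; rfl
    · intro W g hg k hk
      refine hom_ext fun w => Subtype.ext ?_
      exact congrArg (fun k => (hom k).1 w) hk

/-- The closure of the image of a morphism. -/
def closedRange {M N : BanMod R} (f : M ⟶ N) : Submodule R N where
  carrier := closure (Set.range (hom f).1)
  zero_mem' := subset_closure ⟨0, map_zero _⟩
  add_mem' := by
    intro x y hx hy
    refine map_mem_closure₂ continuous_add hx hy ?_
    rintro _ ⟨a, rfl⟩ _ ⟨b, rfl⟩
    exact ⟨a + b, map_add _ _ _⟩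
  smul_mem' := by
    intro a x hx
    obtain ⟨C, hC, h⟩ := N.exists_norm_smul_le
    have hc : Continuous fun y : N => a • y :=
      AddMonoidHomClass.continuous_of_bound
        ((DistribSMul.toAddMonoidHom N a : N →+ N)) (C * ‖a‖) (h a)
    refine map_mem_closure hc hx ?_
    rintro _ ⟨m, rfl⟩
    exact ⟨a • m, (hom f).2 a m⟩

instance : HasCokernels (BanMod R) where
  has_colimit {M N} f := by
    let Q : BanMod R := quot (closedRange f) isClosed_closure
    let p : N ⟶ Q := mkHom (M := N) (N := Q) (closedRange f).mkQ
      ⟨1, fun m => by rw [one_mul]; exact Submodule.Quotient.norm_mk_le _ m⟩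
    have hp : f ≫ p = 0 := hom_ext fun m =>
      (Submodule.Quotient.mk_eq_zero (closedRange f)).2 (subset_closure ⟨m, rfl⟩)
    have hker : ∀ {W : BanMod R} (g : N ⟶ W), f ≫ g = 0 →
        closedRange f ≤ LinearMap.ker (toLin g) := by
      intro W g hg
      refine closure_minimal ?_ (isClosed_ker g)
      rintro _ ⟨m, rfl⟩
      exact congrArg (fun k => (hom k).1 m) hg
    refine ⟨⟨⟨CokernelCofork.ofπ p hp, CokernelCofork.IsColimit.ofπ p hp
      (fun {W} g hg => mkHom (M := Q) ((closedRange f).liftQ (toLin g) (hker g hg)) ?_) ?_ ?_⟩⟩⟩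
    · obtain ⟨C, hC, h⟩ := (hom g).1.bound
      refine ⟨C, fun q => ?_⟩
      refine le_of_forall_pos_le_add fun ε hε => ?_
      obtain ⟨m, hm, hm'⟩ := Submodule.Quotient.norm_mk_lt (S := closedRange f) q (div_pos hε hC)
      subst hm
      have h2 := mul_le_mul_of_nonneg_left hm'.le hC.le
      have h3 : C * (ε / C) = ε := by field_simp
      have h4 : ‖(hom g).1 m‖ ≤ C * ‖m‖ := h m
      calc _ = ‖(hom g).1 m‖ := rfl
        _ ≤ C * ‖m‖ := h4
        _ ≤ _ := by rw [mul_add, h3] at h2; exact h2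
    · intro W g hg; rfl
    · intro W g hg k hk
      refine hom_ext fun q => ?_
      obtain ⟨m, rfl⟩ := Submodule.Quotient.mk_surjective _ q
      exact congrArg (fun k => (hom k).1 m) hk

instance : HasEqualizers (BanMod R) := Preadditive.hasEqualizers_of_hasKernels

instance : HasCoequalizers (BanMod R) := Preadditive.hasCoequalizers_of_hasCokernels

/-! ### Internal Hom -/

instance instSMulLinHom (M N : BanMod R) : SMul R (linHom M N) where
  smul a f := mkHom (a • toLin f) (by
    obtain ⟨C, hC, h⟩ := N.exists_norm_smul_le
    refine ⟨C * ‖a‖ * ‖f.1‖, fun m => ?_⟩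
    have h1 := h a (f.1 m)
    have h2 := mul_le_mul_of_nonneg_left (f.1.le_opNorm m) (by positivity : 0 ≤ C * ‖a‖)
    calc ‖a • f.1 m‖ ≤ C * ‖a‖ * ‖f.1 m‖ := h1
      _ ≤ _ := by rw [mul_assoc (C * ‖a‖)]; exact h2)

lemma linHom_smul_apply {M N : BanMod R} (a : R) (f : linHom M N) (m : M) :
    (a • f).1 m = a • f.1 m := rfl

lemma linHom_ext {M N : BanMod R} {f g : linHom M N} (h : ∀ m, f.1 m = g.1 m) : f = g :=
  Subtype.ext (NormedAddGroupHom.ext h)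

instance instModuleLinHom (M N : BanMod R) : Module R (linHom M N) where
  one_smul f := linHom_ext fun m => one_smul R (f.1 m)
  mul_smul a b f := linHom_ext fun m => mul_smul a b (f.1 m)
  smul_zero a := linHom_ext fun _ => smul_zero a
  smul_add a f g := linHom_ext fun m => smul_add a (f.1 m) (g.1 m)
  add_smul a b f := linHom_ext fun m => add_smul a b (f.1 m)
  zero_smul f := linHom_ext fun m => zero_smul R (f.1 m)

lemma linHom_norm_apply_le {M N : BanMod R} (f : linHom M N) (m : M) :
    ‖f.1 m‖ ≤ ‖f‖ * ‖m‖ := f.1.le_opNorm m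

lemma linHom_norm_le {M N : BanMod R} (f : linHom M N) {C : ℝ} (hC : 0 ≤ C)
    (h : ∀ m, ‖f.1 m‖ ≤ C * ‖m‖) : ‖f‖ ≤ C := f.1.opNorm_le_bound hC h

instance instCompleteSpaceLinHom (M N : BanMod R) : CompleteSpace (linHom M N) := by
  refine Metric.complete_of_cauchySeq_tendsto fun u hu => ?_
  have hpt : ∀ m, CauchySeq fun k => (u k).1 m := by
    intro m
    rw [Metric.cauchySeq_iff'] at hu ⊢
    intro ε hε
    obtain ⟨K, hK⟩ := hu (ε / (‖m‖ + 1)) (by positivity)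
    refine ⟨K, fun n hn => ?_⟩
    have h1 := hK n hn
    rw [dist_eq_norm] at h1 ⊢
    have h2 : ‖(u n).1 m - (u K).1 m‖ ≤ ‖u n - u K‖ * ‖m‖ := linHom_norm_apply_le (u n - u K) m
    have h3 : ‖u n - u K‖ * ‖m‖ ≤ ε / (‖m‖ + 1) * ‖m‖ :=
      mul_le_mul_of_nonneg_right h1.le (norm_nonneg _)
    have h4 : ε / (‖m‖ + 1) * ‖m‖ < ε := by
      rw [div_mul_eq_mul_div, div_lt_iff₀ (by positivity)]
      nlinarith [norm_nonneg m]
    linarith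
  choose g hg using fun m => cauchySeq_tendsto_of_complete (hpt m)
  obtain ⟨B, hB⟩ := hu.norm_bddAbove
  have hB' : ∀ n, ‖u n‖ ≤ B := fun n => hB ⟨n, rfl⟩
  let G : M →ₗ[R] N :=
    { toFun := g
      map_add' := fun x y => tendsto_nhds_unique (hg (x + y))
        (((hg x).add (hg y)).congr fun n => (map_add (u n).1 x y).symm)
      map_smul' := fun a x => by
        obtain ⟨C, hC, h⟩ := N.exists_norm_smul_le
        have hc : Continuous fun y : N => a • y :=
          AddMonoidHomClass.continuous_of_bound
            ((DistribSMul.toAddMonoidHom N a : N →+ N)) (C * ‖a‖) (h a)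
        exact tendsto_nhds_unique (hg (a • x))
          (((hc.tendsto _).comp (hg x)).congr fun n => ((u n).2 a x).symm) }
  have hG : ∀ m, ‖G m‖ ≤ B * ‖m‖ := fun m =>
    le_of_tendsto (hg m).norm (Filter.Eventually.of_forall fun n =>
      (linHom_norm_apply_le (u n) m).trans
        (mul_le_mul_of_nonneg_right (hB' n) (norm_nonneg _)))
  refine ⟨mkHom G ⟨B, hG⟩, ?_⟩
  rw [Metric.tendsto_atTop]
  intro ε hε
  rw [Metric.cauchySeq_iff] at hu
  obtain ⟨K, hK⟩ := hu (ε / 2) (half_pos hε)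
  refine ⟨K, fun n hn => ?_⟩
  rw [dist_eq_norm]
  refine lt_of_le_of_lt (linHom_norm_le _ (half_pos hε).le fun m => ?_) (half_lt_self hε)
  refine le_of_tendsto (((tendsto_const_nhds (x := (u n).1 m)).sub (hg m)).norm)
    (Filter.eventually_atTop.2 ⟨K, fun k hk => ?_⟩)
  have h1 := hK n hn k hk
  rw [dist_eq_norm] at h1
  exact (linHom_norm_apply_le (u n - u k) m).trans
    (mul_le_mul_of_nonneg_right h1.le (norm_nonneg _))

/-- The internal Hom: the Banach module of bounded `R`-linear maps with the operator norm. -/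
def ihom (M N : BanMod R) : BanMod R where
  carrier := linHom M N
  exists_norm_smul_le := by
    obtain ⟨C, hC, h⟩ := N.exists_norm_smul_le
    refine ⟨C, hC, fun a f => linHom_norm_le _ (by positivity) fun m => ?_⟩
    refine (h a (f.1 m)).trans ?_
    rw [mul_assoc (C * ‖a‖)]
    exact mul_le_mul_of_nonneg_left (linHom_norm_apply_le f m) (by positivity)

/-- The functor `N ↦ Hom(M, N)` to Banach modules. -/
def ihomFunctor (M : BanMod R) : BanMod R ⥤ BanMod R where
  obj N := ihom M N
  map {N N'} g := mkHom (M := ihom M N) (N := ihom M N')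
    { toFun := fun f => (show M ⟶ N from f) ≫ g
      map_add' := fun f f' => Preadditive.add_comp M N N' f f' g
      map_smul' := fun a f => linHom_ext fun m => (hom g).2 a _ }
    ⟨‖(hom g).1‖, fun f => linHom_norm_le (M := M) (N := N') _ (by positivity) fun m => by
      refine ((hom g).1.le_opNorm _).trans ?_
      rw [mul_assoc]
      exact mul_le_mul_of_nonneg_left (linHom_norm_apply_le (M := M) (N := N) f m) (norm_nonneg _)⟩
  map_id N := rfl
  map_comp f g := rfl

/-- The unit object: `R` as a Banach module over itself. -/
def unit (R : Type u) [BanachRing R] : BanMod R where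
  carrier := R
  exists_norm_smul_le := BanachRing.exists_norm_mul_le

/-- The dual `M^∨ = Hom(M, R)`. -/
def dual (M : BanMod R) : BanMod R := ihom M (unit R)

/-! ### Completed projective tensor product -/

/-- The algebraic tensor product `M ⊗_R N`, to be equipped with the projective seminorm. -/
def AlgTensor (M N : BanMod R) : Type u := M ⊗[R] N

section AlgTensor

variable (M N : BanMod R)

instance : AddCommGroup (AlgTensor M N) := inferInstanceAs (AddCommGroup (M ⊗[R] N))

instance : Module R (AlgTensor M N) := inferInstanceAs (Module R (M ⊗[R] N))

variable {M N}

/-- The elementary tensor `m ⊗ n` in `M ⊗_R N`. -/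
def atmul (m : M) (n : N) : AlgTensor M N := m ⊗ₜ[R] n

/-- The element `∑ mᵢ ⊗ nᵢ` of `M ⊗_R N` for a finite list of pairs `(mᵢ, nᵢ)`. -/
def sumTmul (l : List (M × N)) : AlgTensor M N := (l.map fun p => atmul p.1 p.2).sum

/-- The number `∑ ‖mᵢ‖ ‖nᵢ‖` for a finite list of pairs `(mᵢ, nᵢ)`. -/
def sumNorm (l : List (M × N)) : ℝ := (l.map fun p => ‖p.1‖ * ‖p.2‖).sum

lemma sumTmul_nil : sumTmul ([] : List (M × N)) = 0 := rfl

lemma sumTmul_cons (p : M × N) (l : List (M × N)) :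
    sumTmul (p :: l) = atmul p.1 p.2 + sumTmul l := by simp only [sumTmul, List.map_cons,
      List.sum_cons]

lemma sumNorm_nil : sumNorm ([] : List (M × N)) = 0 := rfl

lemma sumNorm_cons (p : M × N) (l : List (M × N)) :
    sumNorm (p :: l) = ‖p.1‖ * ‖p.2‖ + sumNorm l := by simp only [sumNorm, List.map_cons,
      List.sum_cons]

lemma sumTmul_append (l l' : List (M × N)) : sumTmul (l ++ l') = sumTmul l + sumTmul l' := by
  simp only [sumTmul, List.map_append, List.sum_append]

lemma sumNorm_append (l l' : List (M × N)) : sumNorm (l ++ l') = sumNorm l + sumNorm l' := by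
  simp only [sumNorm, List.map_append, List.sum_append]

lemma sumNorm_nonneg (l : List (M × N)) : 0 ≤ sumNorm l :=
  List.sum_nonneg (by
    intro x hx
    obtain ⟨p, -, rfl⟩ := List.mem_map.1 hx
    positivity)

lemma exists_sumTmul (x : AlgTensor M N) : ∃ l : List (M × N), sumTmul l = x := by
  refine TensorProduct.induction_on (motive := fun x => ∃ l : List (M × N), sumTmul l = x) x
    ⟨[], rfl⟩ (fun m n => ⟨[(m, n)], ?_⟩) ?_
  · rw [sumTmul_cons, sumTmul_nil, add_zero]; rfl
  · rintro _ _ ⟨l, rfl⟩ ⟨l', rfl⟩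
    exact ⟨l ++ l', sumTmul_append l l'⟩

/-- The projective seminorm: `‖x‖ = inf {∑ ‖mᵢ‖ ‖nᵢ‖ : x = ∑ mᵢ ⊗ nᵢ}`. -/
def projNorm (x : AlgTensor M N) : ℝ := sInf {c | ∃ l : List (M × N), sumTmul l = x ∧ sumNorm l = c}

lemma projNorm_le (l : List (M × N)) : projNorm (sumTmul l) ≤ sumNorm l :=
  csInf_le ⟨0, by rintro _ ⟨l, -, rfl⟩; exact sumNorm_nonneg l⟩ ⟨l, rfl, rfl⟩

lemma projNorm_atmul_le (m : M) (n : N) : projNorm (atmul m n) ≤ ‖m‖ * ‖n‖ := by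
  have := projNorm_le [(m, n)]
  rwa [sumTmul_cons, sumTmul_nil, sumNorm_cons, sumNorm_nil, add_zero, add_zero] at this

lemma projNorm_nonneg (x : AlgTensor M N) : 0 ≤ projNorm x :=
  Real.sInf_nonneg (by rintro _ ⟨l, -, rfl⟩; exact sumNorm_nonneg l)

lemma exists_sumNorm_lt (x : AlgTensor M N) {ε : ℝ} (hε : 0 < ε) :
    ∃ l : List (M × N), sumTmul l = x ∧ sumNorm l < projNorm x + ε := by
  obtain ⟨l, hl⟩ := exists_sumTmul x
  obtain ⟨_, ⟨l, h, rfl⟩, h'⟩ := Real.lt_sInf_add_pos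
    (s := {c | ∃ l : List (M × N), sumTmul l = x ∧ sumNorm l = c}) ⟨_, l, hl, rfl⟩ hε
  exact ⟨l, h, h'⟩

/-- A criterion for boundedness of linear maps out of the projective tensor product. -/
lemma bound_of_tmul {E : Type*} [SeminormedAddCommGroup E] (f : AlgTensor M N →+ E) {C : ℝ}
    (hC : 0 ≤ C) (h : ∀ (m : M) (n : N), ‖f (atmul m n)‖ ≤ C * (‖m‖ * ‖n‖))
    (x : AlgTensor M N) : ‖f x‖ ≤ C * projNorm x := by
  have key : ∀ l : List (M × N), ‖f (sumTmul l)‖ ≤ C * sumNorm l := by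
    intro l
    induction l with
    | nil => rw [sumTmul_nil, sumNorm_nil, map_zero, norm_zero, mul_zero]
    | cons p l ih =>
      rw [sumTmul_cons, sumNorm_cons, map_add, mul_add]
      exact (norm_add_le _ _).trans (add_le_add (h _ _) ih)
  refine le_of_forall_pos_le_add fun ε hε => ?_
  obtain ⟨l, rfl, hl⟩ := exists_sumNorm_lt x (div_pos hε (by positivity : 0 < C + 1))
  have h1 := mul_le_mul_of_nonneg_left hl.le hC
  have h2 : C * (ε / (C + 1)) ≤ ε := by
    rw [mul_div_assoc', div_le_iff₀ (by positivity)]; nlinarith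
  linarith [key l, mul_add C (projNorm (sumTmul l)) (ε / (C + 1))]

lemma projNorm_zero : projNorm (0 : AlgTensor M N) = 0 :=
  le_antisymm (projNorm_le ([] : List (M × N)))
    (projNorm_nonneg _)

lemma projNorm_add_le (x y : AlgTensor M N) : projNorm (x + y) ≤ projNorm x + projNorm y := by
  refine le_of_forall_pos_le_add fun ε hε => ?_
  obtain ⟨l, rfl, hl⟩ := exists_sumNorm_lt x (half_pos hε)
  obtain ⟨l', rfl, hl'⟩ := exists_sumNorm_lt y (half_pos hε)
  have := projNorm_le (l ++ l')
  rw [sumTmul_append, sumNorm_append] at this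
  linarith

lemma projNorm_neg_le (x : AlgTensor M N) : projNorm (-x) ≤ projNorm x := by
  refine le_of_forall_pos_le_add fun ε hε => ?_
  obtain ⟨l, rfl, hl⟩ := exists_sumNorm_lt x hε
  have h1 : ∀ l : List (M × N), sumTmul (l.map fun p => (-p.1, p.2)) = -sumTmul l := by
    intro l
    induction l with
    | nil => rw [List.map_nil, sumTmul_nil, neg_zero]
    | cons p l ih =>
      rw [List.map_cons, sumTmul_cons, sumTmul_cons, ih, neg_add]
      exact congrArg (· + _) (TensorProduct.neg_tmul _ _)
  have h2 : sumNorm (l.map fun p => (-p.1, p.2)) = sumNorm l := by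
    simp [sumNorm, Function.comp_def]
  have := projNorm_le (l.map fun p => (-p.1, p.2))
  rw [h1, h2] at this
  linarith

instance : SeminormedAddCommGroup (AlgTensor M N) :=
  AddGroupSeminorm.toSeminormedAddCommGroup
    { toFun := projNorm
      map_zero' := projNorm_zero
      add_le' := projNorm_add_le
      neg' := fun x => le_antisymm (projNorm_neg_le x) (by simpa using projNorm_neg_le (-x)) }

lemma norm_def (x : AlgTensor M N) : ‖x‖ = projNorm x := rfl

lemma norm_atmul_le (m : M) (n : N) : ‖atmul m n‖ ≤ ‖m‖ * ‖n‖ := projNorm_atmul_le m n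

lemma algTensor_norm_smul_le :
    ∃ C : ℝ, 0 < C ∧ ∀ (a : R) (x : AlgTensor M N), ‖a • x‖ ≤ C * ‖a‖ * ‖x‖ := by
  obtain ⟨C, hC, h⟩ := M.exists_norm_smul_le
  refine ⟨C, hC, fun a x => ?_⟩
  refine bound_of_tmul (DistribSMul.toAddMonoidHom (AlgTensor M N) a) (by positivity) ?_ x
  intro m n
  refine (norm_atmul_le (a • m) n).trans ?_
  rw [← mul_assoc]
  exact mul_le_mul_of_nonneg_right (h a m) (norm_nonneg _)

instance : UniformContinuousConstSMul R (AlgTensor M N) where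
  uniformContinuous_const_smul a := by
    obtain ⟨C, hC, h⟩ := algTensor_norm_smul_le (M := M) (N := N)
    exact AddMonoidHomClass.uniformContinuous_of_bound
      (DistribSMul.toAddMonoidHom (AlgTensor M N) a) (C * ‖a‖) (h a)

end AlgTensor

open UniformSpace

lemma completion_coe_smul {M N : BanMod R} (a : R) (x : AlgTensor M N) :
    ((a • x : AlgTensor M N) : Completion (AlgTensor M N)) = a • (x : Completion (AlgTensor M N)) :=
  Completion.coe_smul a x

lemma continuous_completion_smul (M N : BanMod R) (a : R) :
    Continuous fun x : Completion (AlgTensor M N) => a • x :=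
  continuous_const_smul a

/-- The completed projective tensor product: the separated completion of `M ⊗_R N` with respect to
the projective seminorm. -/
def tensor (M N : BanMod R) : BanMod R where
  carrier := Completion (AlgTensor M N)
  exists_norm_smul_le := by
    obtain ⟨C, hC, h⟩ := algTensor_norm_smul_le (M := M) (N := N)
    refine ⟨C, hC, fun a x => ?_⟩
    induction x using Completion.induction_on with
    | hp => exact isClosed_le (continuous_norm.comp (continuous_const_smul a))
              (continuous_const.mul continuous_norm)
    | ih x =>
      rw [← Completion.coe_smul, Completion.norm_coe, Completion.norm_coe]
      exact h a x

/-- The bounded `R`-linear map `M ⊗̂ N → P` induced by a bounded bilinear map. -/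
def tensorLift {M N P : BanMod R} (f : M →ₗ[R] N →ₗ[R] P)
    (hf : ∃ C : ℝ, 0 ≤ C ∧ ∀ m n, ‖f m n‖ ≤ C * (‖m‖ * ‖n‖)) : tensor M N ⟶ P :=
  let g : NormedAddGroupHom (AlgTensor M N) P :=
    { toFun := TensorProduct.lift f
      map_add' := map_add (TensorProduct.lift f)
      bound' := by
        obtain ⟨C, hC, h⟩ := hf
        exact ⟨C, bound_of_tmul (TensorProduct.lift f).toAddMonoidHom hC h⟩ }
  ⟨g.extension, fun a x => by
    induction x using Completion.induction_on with
    | hp =>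
      obtain ⟨C, hC, h⟩ := P.exists_norm_smul_le
      have hc : Continuous fun y : P => a • y :=
        AddMonoidHomClass.continuous_of_bound
          ((DistribSMul.toAddMonoidHom P a : P →+ P)) (C * ‖a‖) (h a)
      exact isClosed_eq (g.extension.continuous.comp (continuous_completion_smul M N a))
        (hc.comp g.extension.continuous)
    | ih x =>
      change g.extension (a • (x : Completion (AlgTensor M N))) = a • g.extension x
      rw [← completion_coe_smul, NormedAddGroupHom.extension_coe, NormedAddGroupHom.extension_coe]
      exact map_smul (TensorProduct.lift f) a x⟩

/-- The image of `m ⊗ n` in the completed tensor product. -/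
def tmul {M N : BanMod R} (m : M) (n : N) : tensor M N :=
  (atmul m n : Completion (AlgTensor M N))

lemma tensorLift_tmul {M N P : BanMod R} (f : M →ₗ[R] N →ₗ[R] P)
    (hf : ∃ C : ℝ, 0 ≤ C ∧ ∀ m n, ‖f m n‖ ≤ C * (‖m‖ * ‖n‖)) (m : M) (n : N) :
    (hom (tensorLift f hf)).1 (tmul m n) = f m n :=
  (NormedAddGroupHom.extension_coe _ _).trans (TensorProduct.lift.tmul m n)

lemma tensor_hom_ext {M N P : BanMod R} {f g : tensor M N ⟶ P}
    (h : ∀ m n, (hom f).1 (tmul m n) = (hom g).1 (tmul m n)) : f = g := by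
  refine hom_ext fun x => ?_
  change Completion (AlgTensor M N) at x
  induction x using Completion.induction_on with
  | hp => exact isClosed_eq (hom f).1.continuous (hom g).1.continuous
  | ih x =>
    obtain ⟨l, rfl⟩ := exists_sumTmul x
    induction l with
    | nil => exact (map_zero (hom f).1).trans (map_zero (hom g).1).symm
    | cons p l ih =>
      have h1 : ((sumTmul (p :: l) : AlgTensor M N) : Completion (AlgTensor M N))
          = (show Completion (AlgTensor M N) from tmul p.1 p.2) +
            ((sumTmul l : AlgTensor M N) : Completion (AlgTensor M N)) :=
        Completion.coe_add _ _
      rw [h1]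
      exact (map_add (hom f).1 _ _).trans
        ((congrArg₂ (· + ·) (h _ _) ih).trans (map_add (hom g).1 _ _).symm)

lemma norm_tmul_le {M N : BanMod R} (m : M) (n : N) : ‖tmul m n‖ ≤ ‖m‖ * ‖n‖ :=
  (Completion.norm_coe _).le.trans (norm_atmul_le m n)

/-- The canonical bilinear map `M × N → M ⊗̂ N`. -/
def tmulBilin (M N : BanMod R) : M →ₗ[R] N →ₗ[R] tensor M N :=
  LinearMap.mk₂ R tmul
    (fun m m' n => (congrArg _ (TensorProduct.add_tmul m m' n)).trans (Completion.coe_add _ _))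
    (fun a m n => (congrArg _ (TensorProduct.smul_tmul' a m n).symm).trans
      (completion_coe_smul _ _))
    (fun m n n' => (congrArg _ (TensorProduct.tmul_add m n n')).trans (Completion.coe_add _ _))
    (fun a m n => (congrArg _ (TensorProduct.tmul_smul a m n)).trans (completion_coe_smul _ _))

/-- The bilinear map `(m, n) ↦ f m ⊗ g n`. -/
def tensorMapBilin {M M' N N' : BanMod R} (f : M ⟶ M') (g : N ⟶ N') :
    M →ₗ[R] N →ₗ[R] tensor M' N' :=
  LinearMap.mk₂ R (fun m n => tmul ((hom f).1 m) ((hom g).1 n))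
    (fun m m' n => (congrArg (fun y => tmul y ((hom g).1 n)) (map_add (hom f).1 m m')).trans
      (LinearMap.map_add₂ (tmulBilin M' N') _ _ _))
    (fun a m n => (congrArg (fun y => tmul y ((hom g).1 n)) ((hom f).2 a m)).trans
      (LinearMap.map_smul₂ (tmulBilin M' N') _ _ _))
    (fun m n n' => (congrArg (fun y => tmul ((hom f).1 m) y) (map_add (hom g).1 n n')).trans
      (map_add (tmulBilin M' N' ((hom f).1 m)) _ _))
    (fun a m n => (congrArg (fun y => tmul ((hom f).1 m) y) ((hom g).2 a n)).trans
      (map_smul (tmulBilin M' N' ((hom f).1 m)) _ _))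

lemma tensorMapBilin_bound {M M' N N' : BanMod R} (f : M ⟶ M') (g : N ⟶ N') (m : M) (n : N) :
    ‖tensorMapBilin f g m n‖ ≤ ‖(hom f).1‖ * ‖(hom g).1‖ * (‖m‖ * ‖n‖) := by
  refine (norm_tmul_le ((hom f).1 m) ((hom g).1 n)).trans ?_
  refine (mul_le_mul ((hom f).1.le_opNorm m) ((hom g).1.le_opNorm n) (norm_nonneg _)
    (mul_nonneg (norm_nonneg _) (norm_nonneg _))).trans_eq ?_
  exact mul_mul_mul_comm _ _ _ _

/-- Functoriality of the completed tensor product: `m ⊗ n ↦ f m ⊗ g n`. -/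
def tensorMap {M M' N N' : BanMod R} (f : M ⟶ M') (g : N ⟶ N') : tensor M N ⟶ tensor M' N' :=
  tensorLift (tensorMapBilin f g)
    ⟨_, mul_nonneg (norm_nonneg (hom f).1) (norm_nonneg (hom g).1), tensorMapBilin_bound f g⟩

lemma tensorMap_tmul {M M' N N' : BanMod R} (f : M ⟶ M') (g : N ⟶ N') (m : M) (n : N) :
    (hom (tensorMap f g)).1 (tmul m n) = tmul ((hom f).1 m) ((hom g).1 n) :=
  tensorLift_tmul _ _ _ _

lemma tensorMap_id (M N : BanMod R) : tensorMap (𝟙 M) (𝟙 N) = 𝟙 (tensor M N) :=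
  tensor_hom_ext fun m n => tensorMap_tmul (𝟙 M) (𝟙 N) m n

lemma tensorMap_comp {M M' M'' N N' N'' : BanMod R} (f : M ⟶ M') (f' : M' ⟶ M'') (g : N ⟶ N')
    (g' : N' ⟶ N'') :
    tensorMap (f ≫ f') (g ≫ g') = tensorMap f g ≫ tensorMap f' g' :=
  tensor_hom_ext fun m n => by
    rw [hom_comp, tensorMap_tmul, tensorMap_tmul, tensorMap_tmul, hom_comp, hom_comp]

/-- The functor `N ↦ M ⊗̂ N`. -/
def tensorLeftFunctor (M : BanMod R) : BanMod R ⥤ BanMod R where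
  obj N := tensor M N
  map g := tensorMap (𝟙 M) g
  map_id N := tensorMap_id M N
  map_comp f g := by rw [← tensorMap_comp, Category.comp_id]

/-- The bifunctor `(M, N) ↦ M ⊗̂ N` on `Ban_R`. -/
def tensorFunctor (R : Type u) [BanachRing R] : BanMod R ⥤ BanMod R ⥤ BanMod R where
  obj M := tensorLeftFunctor M
  map {M M'} f :=
    { app := fun N => tensorMap f (𝟙 N)
      naturality := fun N N' g => by
        change tensorMap (𝟙 M) g ≫ tensorMap f (𝟙 N') = tensorMap f (𝟙 N) ≫ tensorMap (𝟙 M') g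
        rw [← tensorMap_comp, ← tensorMap_comp, Category.comp_id, Category.id_comp,
          Category.comp_id, Category.id_comp] }
  map_id M := NatTrans.ext (funext fun N => tensorMap_id M N)
  map_comp f g := NatTrans.ext (funext fun N =>
    (congrArg (tensorMap (f ≫ g)) (Category.comp_id (𝟙 N)).symm).trans
      (tensorMap_comp f g (𝟙 N) (𝟙 N)))

/-- The functional underlying an element of the dual. -/
def dualApply {W : BanMod R} (φ : dual W) : W →ₗ[R] R := toLin (M := W) (N := unit R) φ

lemma norm_dualApply_le {W : BanMod R} (φ : dual W) (w : W) : ‖dualApply φ w‖ ≤ ‖φ‖ * ‖w‖ :=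
  linHom_norm_apply_le (M := W) (N := unit R) φ w

lemma exists_norm_dualApply_smul_le (W V : BanMod R) : ∃ C : ℝ, 0 ≤ C ∧
    ∀ (φ : dual W) (v : V) (w : W), ‖dualApply φ w • v‖ ≤ C * (‖φ‖ * ‖v‖) * ‖w‖ := by
  obtain ⟨C, hC, h⟩ := V.exists_norm_smul_le
  refine ⟨C, hC.le, fun φ v w => (h _ v).trans ?_⟩
  have := mul_le_mul_of_nonneg_left (norm_dualApply_le φ w) (by positivity : 0 ≤ C * ‖v‖)
  nlinarith

/-- The rank one map `w ↦ φ(w) v`. -/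
def rankOne {W V : BanMod R} (φ : dual W) (v : V) : linHom W V :=
  mkHom ((dualApply φ).smulRight v) (by
    obtain ⟨C, -, h⟩ := exists_norm_dualApply_smul_le W V
    exact ⟨_, h φ v⟩)

lemma rankOne_apply {W V : BanMod R} (φ : dual W) (v : V) (w : W) :
    (rankOne φ v).1 w = dualApply φ w • v := rfl

/-- The bilinear map `(φ, v) ↦ (w ↦ φ(w) v)`. -/
def rankOneBilin (W V : BanMod R) : dual W →ₗ[R] V →ₗ[R] ihom W V :=
  LinearMap.mk₂ R (fun φ v => (rankOne φ v : linHom W V))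
    (fun φ φ' v => linHom_ext fun w => add_smul (dualApply φ w) (dualApply φ' w) v)
    (fun a φ v => linHom_ext fun w => mul_smul a (dualApply φ w) v)
    (fun φ v v' => linHom_ext fun w => smul_add (dualApply φ w) v v')
    (fun a φ v => linHom_ext fun w => smul_comm (dualApply φ w) a v)

/-- The natural morphism `W^∨ ⊗̂ V → Hom(W, V)`, `φ ⊗ v ↦ (w ↦ φ(w) v)`. -/
def dualTensorHom (W V : BanMod R) : tensor (dual W) V ⟶ ihom W V :=
  tensorLift (rankOneBilin W V) (by
    obtain ⟨C, hC, h⟩ := exists_norm_dualApply_smul_le W V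
    exact ⟨C, hC, fun φ v =>
      linHom_norm_le (rankOne φ v) (mul_nonneg hC (by positivity)) (h φ v)⟩)

lemma dualTensorHom_tmul (W V : BanMod R) (φ : dual W) (v : V) :
    (hom (dualTensorHom W V)).1 (tmul φ v) = rankOne φ v :=
  tensorLift_tmul _ _ φ v

/-- The natural morphism `W^∨ ⊗̂ V → Hom(W, V)` as a natural transformation in `V`. -/
def dualTensorHomNat (W : BanMod R) : (tensorFunctor R).obj (dual W) ⟶ ihomFunctor W where
  app V := dualTensorHom W V
  naturality V V' g := tensor_hom_ext fun φ v => by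
    refine Eq.trans (b := rankOne φ ((hom g).1 v)) ?_ ?_
    · refine Eq.trans ?_ (dualTensorHom_tmul W V' φ ((hom g).1 v))
      exact congrArg (hom (dualTensorHom W V')).1 (tensorMap_tmul (𝟙 (dual W)) g φ v)
    · refine Eq.trans ?_
        (congrArg (hom ((ihomFunctor W).map g)).1 (dualTensorHom_tmul W V φ v)).symm
      exact linHom_ext fun w => ((hom g).2 (dualApply φ w) v).symm

end

end BanMod

noncomputable section

/-! ### Extension of functors to ind-objects -/

namespace IndExt

variable {C : Type u} [Category.{v} C]

instance hasPointwiseLeftKanExtension (F : C ⥤ Ind C) :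
    (Ind.yoneda (C := C)).HasPointwiseLeftKanExtension F := by
  intro X
  let e : CostructuredArrow Ind.yoneda X ≌
      CostructuredArrow yoneda ((Ind.inclusion C).obj X) :=
    (CostructuredArrow.post Ind.yoneda (Ind.inclusion C) X).asEquivalence.trans
      (CostructuredArrow.mapNatIso Ind.yonedaCompInclusion)
  let P := X.presentation
  exact Functor.Final.hasColimit_of_comp (P.toCostructuredArrow ⋙ e.inverse)

/-- The extension to ind-objects of a functor `C ⥤ C`, namely its left Kan extension along
`C ⥤ Ind C`, which sends `"colim" Vᵢ` to `"colim" F(Vᵢ)`. -/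
def ext : (C ⥤ C) ⥤ (Ind C ⥤ Ind C) :=
  (Functor.whiskeringRight C C (Ind C)).obj Ind.yoneda ⋙ Ind.yoneda.lan

/-- The extension to ind-objects of a bifunctor on `C` (a left Kan extension in each variable),
which sends `("colim" Vᵢ, "colim" Wⱼ)` to `"colim" T(Vᵢ, Wⱼ)`. -/
def ext₂ (T : C ⥤ C ⥤ C) : Ind C ⥤ Ind C ⥤ Ind C :=
  ((T ⋙ ext).flip ⋙ Ind.yoneda.lan).flip

/-- If the first variable is an object `A` of `C`, the extension of the bifunctor `T` is the
extension of the functor `T(A, -)`. -/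
def ext₂Iso (T : C ⥤ C ⥤ C) (A : C) (Y : Ind C) :
    ((ext₂ T).obj (Ind.yoneda.obj A)).obj Y ≅ (ext.obj (T.obj A)).obj Y :=
  (asIso ((Ind.yoneda.lanUnit.app ((T ⋙ ext).flip.obj Y)).app A)).symm

end IndExt

/-! ### Strict monomorphisms, nuclear objects and flat objects of `Ind(Ban_R)` -/

namespace IndBan

variable {R : Type u} [BanachRing R]

lemma isZero_yoneda_zero : IsZero (Ind.yoneda.obj (BanMod.zero R)) where
  unique_to Y :=
    let h := IsInitial.isInitialObj Ind.yoneda _ (BanMod.isZero_zero (R := R)).isInitial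
    ⟨⟨⟨h.to Y⟩, fun _ => h.hom_ext _ _⟩⟩
  unique_from Y :=
    let h := IsTerminal.isTerminalObj Ind.yoneda _ (BanMod.isZero_zero (R := R)).isTerminal
    ⟨⟨⟨h.from Y⟩, fun _ => h.hom_ext _ _⟩⟩

instance : HasZeroObject (Ind (BanMod R)) := ⟨_, isZero_yoneda_zero⟩

/-- The zero morphisms of `Ind(Ban_R)`: those that factor through the zero object. -/
instance : HasZeroMorphisms (Ind (BanMod R)) := HasZeroObject.zeroMorphismsOfZeroObject

/-- A strict monomorphism of `Ind(Ban_R)`: a monomorphism `f` such that the canonical morphism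
`coim f ⟶ im f` is an isomorphism. -/
def IsStrictMono {E F : Ind (BanMod R)} (f : E ⟶ F) : Prop :=
  Mono f ∧ IsIso (Abelian.coimageImageComparison f)

/-- The completed projective tensor product `X ⊗̂ Y` on `Ind(Ban_R)`. -/
def tensor (R : Type u) [BanachRing R] :
    Ind (BanMod R) ⥤ Ind (BanMod R) ⥤ Ind (BanMod R) :=
  IndExt.ext₂ (BanMod.tensorFunctor R)

/-- `V` is flat if the functor `(-) ⊗̂ V` preserves strict monomorphisms. -/
def IsFlat (V : Ind (BanMod R)) : Prop :=
  ∀ ⦃E F : Ind (BanMod R)⦄ (f : E ⟶ F), IsStrictMono f →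
    IsStrictMono (((tensor R).flip.obj V).map f)

/-- The internal Hom `Hom(W, V)` for `W` in `Ban_R` and `V` in `Ind(Ban_R)`: it is
`"colim" Hom(W, Vᵢ)` for `V = "colim" Vᵢ`. -/
def ihom (W : BanMod R) (V : Ind (BanMod R)) : Ind (BanMod R) :=
  (IndExt.ext.obj (BanMod.ihomFunctor W)).obj V

/-- The natural morphism `W^∨ ⊗̂ V ⟶ Hom(W, V)` for `W` in `Ban_R` and `V` in `Ind(Ban_R)`.  For
`V = "colim" Vᵢ` it is induced by the natural morphisms `W^∨ ⊗̂ Vᵢ ⟶ Hom(W, Vᵢ)`. -/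
def dualTensorHom (W : BanMod R) (V : Ind (BanMod R)) :
    ((tensor R).obj (Ind.yoneda.obj (BanMod.dual W))).obj V ⟶ ihom W V :=
  (IndExt.ext₂Iso (BanMod.tensorFunctor R) (BanMod.dual W) V).hom ≫
    (IndExt.ext.map (BanMod.dualTensorHomNat W)).app V

/-- `V` is nuclear if `W^∨ ⊗̂ V ⟶ Hom(W, V)` is an isomorphism for every Banach module `W`. -/
def IsNuclear (V : Ind (BanMod R)) : Prop :=
  ∀ W : BanMod R, IsIso (dualTensorHom W V)

end IndBan

end

noncomputable section

/-! ### Disk algebras -/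

/-- Polyradii: `n`-tuples of positive real numbers, ordered coordinatewise. -/
abbrev PolyRadius (n : ℕ) : Type := {ρ : Fin n → ℝ // ∀ i, 0 < ρ i}

namespace PolyRadius

/-- The monomial `ρ^J = ∏ ρᵢ^{Jᵢ}`. -/
def pow {n : ℕ} (ρ : PolyRadius n) (J : Fin n →₀ ℕ) : ℝ := ∏ i, ρ.1 i ^ J i

lemma pow_pos {n : ℕ} (ρ : PolyRadius n) (J : Fin n →₀ ℕ) : 0 < ρ.pow J :=
  Finset.prod_pos fun i _ => _root_.pow_pos (ρ.2 i) _

lemma pow_le_pow {n : ℕ} {ρ τ : PolyRadius n} (h : ρ ≤ τ) (J : Fin n →₀ ℕ) : ρ.pow J ≤ τ.pow J :=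
  Finset.prod_le_prod (fun i _ => (_root_.pow_pos (ρ.2 i) _).le)
    fun i _ => pow_le_pow_left₀ (ρ.2 i).le (h i) _

end PolyRadius

namespace Disk

variable {R : Type u} [BanachRing R] {n : ℕ}

/-- The power series `∑ a_J x^J` with `∑ |a_J| ρ^J < ∞`. -/
def submodule (R : Type u) [BanachRing R] {n : ℕ} (ρ : PolyRadius n) :
    Submodule R (MvPowerSeries (Fin n) R) where
  carrier := {f | Summable fun J => ‖MvPowerSeries.coeff J f‖ * ρ.pow J}
  zero_mem' := by
    simp
  add_mem' := by
    intro f g hf hg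
    refine Summable.of_nonneg_of_le (fun J => mul_nonneg (norm_nonneg _) (ρ.pow_pos J).le)
      (fun J => ?_) (hf.add hg)
    rw [map_add, ← add_mul]
    exact mul_le_mul_of_nonneg_right (norm_add_le _ _) (ρ.pow_pos J).le
  smul_mem' := by
    intro a f hf
    obtain ⟨C, hC, h⟩ := BanachRing.exists_norm_mul_le (R := R)
    refine Summable.of_nonneg_of_le (fun J => mul_nonneg (norm_nonneg _) (ρ.pow_pos J).le)
      (fun J => ?_) (Summable.mul_left (C * ‖a‖) hf)
    rw [← mul_assoc]
    exact mul_le_mul_of_nonneg_right (h a _) (ρ.pow_pos J).le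

/-- The underlying module of the disk algebra. -/
def Carrier (R : Type u) [BanachRing R] {n : ℕ} (ρ : PolyRadius n) : Type u := submodule R ρ

instance (ρ : PolyRadius n) : AddCommGroup (Carrier R ρ) :=
  inferInstanceAs (AddCommGroup (submodule R ρ))

instance (ρ : PolyRadius n) : Module R (Carrier R ρ) := inferInstanceAs (Module R (submodule R ρ))

/-- The coefficient `a_J` of `f = ∑ a_J x^J`. -/
def coeff {ρ : PolyRadius n} (J : Fin n →₀ ℕ) : Carrier R ρ →ₗ[R] R :=
  (MvPowerSeries.coeff J).comp (submodule R ρ).subtype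

lemma ext {ρ : PolyRadius n} {f g : Carrier R ρ} (h : ∀ J, coeff J f = coeff J g) : f = g :=
  Subtype.ext (MvPowerSeries.ext h)

lemma summable {ρ : PolyRadius n} (f : Carrier R ρ) : Summable fun J => ‖coeff J f‖ * ρ.pow J := f.2

/-- The element with given coefficients. -/
def mk {ρ : PolyRadius n} (a : (Fin n →₀ ℕ) → R) (h : Summable fun J => ‖a J‖ * ρ.pow J) :
    Carrier R ρ := ⟨(a : MvPowerSeries (Fin n) R), h⟩

lemma coeff_mk {ρ : PolyRadius n} (a : (Fin n →₀ ℕ) → R)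
    (h : Summable fun J => ‖a J‖ * ρ.pow J) (J : Fin n →₀ ℕ) : coeff J (mk a h) = a J := rfl

lemma term_nonneg {ρ : PolyRadius n} (f : Carrier R ρ) (J : Fin n →₀ ℕ) :
    0 ≤ ‖coeff J f‖ * ρ.pow J := mul_nonneg (norm_nonneg _) (ρ.pow_pos J).le

/-- The norm `∑ |a_J| ρ^J`. -/
instance instNormedAddCommGroup (ρ : PolyRadius n) : NormedAddCommGroup (Carrier R ρ) :=
  AddGroupNorm.toNormedAddCommGroup
    { toFun := fun f => ∑' J, ‖coeff J f‖ * ρ.pow J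
      map_zero' := by simp
      add_le' := fun f g => by
        rw [← (summable f).tsum_add (summable g)]
        refine (summable (f + g)).tsum_le_tsum (fun J => ?_) ((summable f).add (summable g))
        rw [map_add, ← add_mul]
        exact mul_le_mul_of_nonneg_right (norm_add_le _ _) (ρ.pow_pos J).le
      neg' := fun f => by simp
      eq_zero_of_map_eq_zero' := fun f hf => ext fun J => by
        have h := ((summable f).hasSum_iff.2 hf)
        have h' := (hasSum_zero_iff_of_nonneg (term_nonneg f)).1 h
        have h'' := congrFun h' J
        rw [Pi.zero_apply, mul_eq_zero, or_iff_left (ρ.pow_pos J).ne', norm_eq_zero] at h''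
        rw [h'', map_zero] }

lemma norm_def {ρ : PolyRadius n} (f : Carrier R ρ) : ‖f‖ = ∑' J, ‖coeff J f‖ * ρ.pow J := rfl

lemma norm_coeff_mul_le {ρ : PolyRadius n} (f : Carrier R ρ) (J : Fin n →₀ ℕ) :
    ‖coeff J f‖ * ρ.pow J ≤ ‖f‖ := (summable f).le_tsum J fun K _ => term_nonneg f K

lemma sum_le_norm {ρ : PolyRadius n} (f : Carrier R ρ) (s : Finset (Fin n →₀ ℕ)) :
    ∑ J ∈ s, ‖coeff J f‖ * ρ.pow J ≤ ‖f‖ := (summable f).sum_le_tsum s fun K _ => term_nonneg f K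

instance instCompleteSpace (ρ : PolyRadius n) : CompleteSpace (Carrier R ρ) := by
  refine Metric.complete_of_cauchySeq_tendsto fun u hu => ?_
  have hpt : ∀ J, CauchySeq fun k => coeff J (u k) := fun J =>
    (AddMonoidHomClass.uniformContinuous_of_bound (coeff (R := R) (ρ := ρ) J) (ρ.pow J)⁻¹
      fun f => by
        rw [← div_eq_inv_mul, le_div_iff₀ (ρ.pow_pos J)]
        exact norm_coeff_mul_le f J).comp_cauchySeq hu
  choose a ha using fun J => cauchySeq_tendsto_of_complete (hpt J)
  obtain ⟨B, hB⟩ := hu.norm_bddAbove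
  have hB' : ∀ k, ‖u k‖ ≤ B := fun k => hB ⟨k, rfl⟩
  have hsum : Summable fun J => ‖a J‖ * ρ.pow J := by
    refine summable_of_sum_le (c := B)
      (fun J => mul_nonneg (norm_nonneg _) (ρ.pow_pos J).le) fun s => ?_
    refine le_of_tendsto (tendsto_finsetSum s fun J _ => (ha J).norm.mul_const (ρ.pow J))
      (Filter.Eventually.of_forall fun k => (sum_le_norm (u k) s).trans (hB' k))
  refine ⟨mk a hsum, ?_⟩
  rw [Metric.tendsto_atTop]
  intro ε hε
  rw [Metric.cauchySeq_iff] at hu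
  obtain ⟨K, hK⟩ := hu (ε / 2) (half_pos hε)
  refine ⟨K, fun k hk => ?_⟩
  rw [dist_eq_norm]
  refine lt_of_le_of_lt ?_ (half_lt_self hε)
  rw [norm_def]
  refine (summable _).tsum_le_of_sum_le fun s => ?_
  have hlim : Filter.Tendsto (fun l => ∑ J ∈ s, ‖coeff J (u k) - coeff J (u l)‖ * ρ.pow J)
      Filter.atTop (nhds (∑ J ∈ s, ‖coeff J (u k) - a J‖ * ρ.pow J)) :=
    tendsto_finsetSum s fun J _ =>
      ((tendsto_const_nhds.sub (ha J)).norm).mul_const (ρ.pow J)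
  refine le_of_tendsto hlim (Filter.eventually_atTop.2 ⟨K, fun l hl => ?_⟩)
  have h1 := hK k hk l hl
  rw [dist_eq_norm] at h1
  refine le_trans ?_ ((sum_le_norm (u k - u l) s).trans h1.le)
  exact le_of_eq (Finset.sum_congr rfl fun J _ => by rw [map_sub])

lemma term_le {ρ τ : PolyRadius n} (h : ρ ≤ τ) (f : Carrier R τ) (J : Fin n →₀ ℕ) :
    ‖coeff J f‖ * ρ.pow J ≤ ‖coeff J f‖ * τ.pow J :=
  mul_le_mul_of_nonneg_left (PolyRadius.pow_le_pow h J) (norm_nonneg _)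

/-- For `ρ ≤ τ`, a series that converges for `τ` converges for `ρ`. -/
def restrict {ρ τ : PolyRadius n} (h : ρ ≤ τ) : Carrier R τ →ₗ[R] Carrier R ρ where
  toFun f := mk (fun J => coeff J f) (Summable.of_nonneg_of_le
    (fun J => mul_nonneg (norm_nonneg _) (ρ.pow_pos J).le) (term_le h f) (summable f))
  map_add' f g := ext fun J => by
    rw [coeff_mk, map_add, map_add, coeff_mk, coeff_mk]
  map_smul' a f := ext fun J => by
    rw [coeff_mk, map_smul, map_smul, coeff_mk, RingHom.id_apply]

lemma coeff_restrict {ρ τ : PolyRadius n} (h : ρ ≤ τ) (f : Carrier R τ) (J : Fin n →₀ ℕ) :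
    coeff J (restrict h f) = coeff J f := coeff_mk _ _ J

lemma norm_restrict_le {ρ τ : PolyRadius n} (h : ρ ≤ τ) (f : Carrier R τ) :
    ‖restrict h f‖ ≤ 1 * ‖f‖ := by
  rw [one_mul, norm_def, norm_def]
  refine (summable (restrict h f)).tsum_le_tsum (fun J => ?_) (summable f)
  rw [coeff_restrict]
  exact term_le h f J

end Disk

/-- The polydisk algebra `R{x₁/ρ₁, …, xₙ/ρₙ}` as a Banach module: the power series `∑ a_J x^J`
with `∑ |a_J| ρ^J < ∞`, with this sum as norm. -/
def diskAlgebra (R : Type u) [BanachRing R] {n : ℕ} (ρ : PolyRadius n) : BanMod R where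
  carrier := Disk.Carrier R ρ
  exists_norm_smul_le := by
    obtain ⟨C, hC, h⟩ := BanachRing.exists_norm_mul_le (R := R)
    refine ⟨C, hC, fun a f => ?_⟩
    rw [Disk.norm_def, Disk.norm_def, ← tsum_mul_left]
    refine (Disk.summable (a • f)).tsum_le_tsum (fun J => ?_) ((Disk.summable f).mul_left _)
    rw [← mul_assoc]
    exact mul_le_mul_of_nonneg_right (h a _) (ρ.pow_pos J).le

/-- The restriction morphism `R{x/τ} ⟶ R{x/ρ}` for `ρ ≤ τ`: it is the identity on power series. -/
def diskRestrict (R : Type u) [BanachRing R] {n : ℕ} {ρ τ : PolyRadius n} (h : ρ ≤ τ) :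
    diskAlgebra R τ ⟶ diskAlgebra R ρ :=
  BanMod.mkHom (M := diskAlgebra R τ) (N := diskAlgebra R ρ) (Disk.restrict h)
    ⟨1, Disk.norm_restrict_le h⟩

/-- The system of the polydisk algebras and the restriction morphisms. -/
def diskFunctor (R : Type u) [BanachRing R] (n : ℕ) : (PolyRadius n)ᵒᵖ ⥤ BanMod R where
  obj ρ := diskAlgebra R ρ.unop
  map f := diskRestrict R (leOfHom f.unop)
  map_id _ := BanMod.hom_ext fun f => Disk.ext fun J => Disk.coeff_restrict le_rfl f J
  map_comp f g := BanMod.hom_ext fun φ => Disk.ext fun J =>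
    (Disk.coeff_restrict (leOfHom (f ≫ g).unop) φ J).trans
      ((Disk.coeff_restrict (leOfHom g.unop) (Disk.restrict (leOfHom f.unop) φ) J).trans
        (Disk.coeff_restrict (leOfHom f.unop) φ J)).symm

/-- The polyradii `ρ` with `ρ < τ` in every coordinate, for an `n`-tuple `τ` in `[0, ∞]`. -/
abbrev RadiiBelow {n : ℕ} (τ : Fin n → ℝ≥0∞) : Type :=
  {ρ : PolyRadius n // ∀ i, ENNReal.ofReal (ρ.1 i) < τ i}

/-- The system of the `R{x₁/ρ₁, …, xₙ/ρₙ}` for `ρ < τ`, whose limit in `Ind(Ban_R)` is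
`𝒪(D^n_{<τ, R})`. -/
def openDiskSystem (R : Type u) [BanachRing R] {n : ℕ} (τ : Fin n → ℝ≥0∞) :
    (RadiiBelow τ)ᵒᵖ ⥤ Ind (BanMod R) :=
  (Subtype.mono_coe _).functor.op ⋙ diskFunctor R n ⋙ Ind.yoneda

/-- The polyradius `(r, …, r)`. -/
def constRadius (n : ℕ) (r : ℕ+) : PolyRadius n := ⟨fun _ => (r : ℝ), fun _ => by positivity⟩

lemma constRadius_mono (n : ℕ) : Monotone (constRadius n) := fun _ _ h _ =>
  Nat.cast_le.2 h

/-- The system of the `R{x₁/r, …, xₙ/r}` for positive integers `r`, whose limit in `Ind(Ban_R)` is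
`𝒪(𝔸^n_R)`. -/
def affineSpaceSystem (R : Type u) [BanachRing R] (n : ℕ) : ℕ+ᵒᵖ ⥤ Ind (BanMod R) :=
  (constRadius_mono n).functor.op ⋙ diskFunctor R n ⋙ Ind.yoneda

end

/-! ### Filtered colimits and extension to ind-objects -/

noncomputable section

namespace IndExt

section General

variable {A D I : Type*} [Category* A] [Category* D] [Category* I]

/-- Two functors that are pointwise colimits of the same diagrams are isomorphic. -/
def isoOfIsColimit {P Q : A ⥤ D} (K : A ⥤ I ⥤ D)
    (p : ∀ a, K.obj a ⟶ (Functor.const I).obj (P.obj a)) (hp : ∀ a, IsColimit (Cocone.mk _ (p a)))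
    (q : ∀ a, K.obj a ⟶ (Functor.const I).obj (Q.obj a)) (hq : ∀ a, IsColimit (Cocone.mk _ (q a)))
    (np : ∀ {a b} (f : a ⟶ b) (i : I), (p a).app i ≫ P.map f = (K.map f).app i ≫ (p b).app i)
    (nq : ∀ {a b} (f : a ⟶ b) (i : I), (q a).app i ≫ Q.map f = (K.map f).app i ≫ (q b).app i) :
    P ≅ Q :=
  have h : ∀ a i, (p a).app i ≫ ((hp a).coconePointUniqueUpToIso (hq a)).hom = (q a).app i :=
    fun a i => (hp a).comp_coconePointUniqueUpToIso_hom (hq a) i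
  NatIso.ofComponents (fun a => (hp a).coconePointUniqueUpToIso (hq a)) fun {a b} f => by
    refine (hp a).hom_ext fun i => ?_
    dsimp only
    rw [reassoc_of% np f i, h b i, reassoc_of% h a i, nq f i]

/-- A transformation that becomes invertible after passage to a later index induces an
isomorphism of filtered colimits. -/
lemma isIso_of_isColimit [IsFiltered I] {K K' : I ⥤ D} {c : Cocone K} {c' : Cocone K'}
    (hc : IsColimit c) (hc' : IsColimit c') (α : K ⟶ K') (φ : c.pt ⟶ c'.pt)
    (hφ : ∀ i, c.ι.app i ≫ φ = α.app i ≫ c'.ι.app i) (S : I → I) (s : ∀ i, i ⟶ S i)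
    (β : ∀ i, K'.obj i ⟶ K.obj (S i)) (h₁ : ∀ i, β i ≫ α.app (S i) = K'.map (s i))
    (h₂ : ∀ i, α.app i ≫ β i = K.map (s i)) : IsIso φ := by
  have key : ∀ {i j k : I} (f : i ⟶ j) (p : S i ⟶ k) (q : S j ⟶ k), s i ≫ p = f ≫ s j ≫ q →
      β i ≫ K.map (p ≫ s k) = K'.map f ≫ β j ≫ K.map (q ≫ s k) := by
    intro i j k f p q w
    have e : ∀ {l : I} (r : l ⟶ k), K.map (r ≫ s k) = α.app l ≫ K'.map r ≫ β k := fun r => by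
      rw [← α.naturality_assoc, h₂, ← K.map_comp]
    rw [e p, e q, reassoc_of% h₁, reassoc_of% h₁]
    simp only [← K'.map_comp_assoc]
    rw [w]
  let d : Cocone K' :=
    { pt := c.pt
      ι :=
        { app := fun i => β i ≫ c.ι.app (S i)
          naturality := fun i j f => by
            obtain ⟨k, p, q, w⟩ := IsFiltered.span (s i) (f ≫ s j)
            have h := key f p q (by rw [w, Category.assoc])
            have h' := congrArg (· ≫ c.ι.app (S k)) h
            simp only [Category.assoc, c.w] at h'
            simpa using h'.symm } }
  refine ⟨hc'.desc d, hc.hom_ext fun i => ?_, hc'.hom_ext fun i => ?_⟩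
  · rw [reassoc_of% hφ, hc'.fac]
    dsimp only [d]
    rw [reassoc_of% h₂, c.w, Category.comp_id]
  · rw [hc'.fac_assoc]
    dsimp only [d]
    rw [Category.assoc, hφ, reassoc_of% h₁, c'.w, Category.comp_id]

end General

variable {C : Type u} [Category.{v} C]

section Colimit

variable {I : Type v} [SmallCategory I] [IsFiltered I] {F : I ⥤ C}

/-- The functor to the comma category defined by a cocone over a diagram of objects of `C`. -/
def toArrow (c : Cocone (F ⋙ Ind.yoneda)) : I ⥤ CostructuredArrow Ind.yoneda c.pt :=
  c.toCostructuredArrow ⋙ CostructuredArrow.pre F Ind.yoneda c.pt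

/-- The image in presheaves of a cocone of ind-objects. -/
def presheafCocone (c : Cocone (F ⋙ Ind.yoneda)) : Cocone (F ⋙ yoneda) :=
  (Cocone.precompose (Functor.isoWhiskerLeft F Ind.yonedaCompInclusion).inv).obj
    ((Ind.inclusion C).mapCocone c)

/-- The image in presheaves of a filtered colimit cocone is a colimit cocone. -/
def isColimitPresheafCocone {c : Cocone (F ⋙ Ind.yoneda)} (hc : IsColimit c) :
    IsColimit (presheafCocone c) :=
  (IsColimit.precomposeInvEquiv (Functor.isoWhiskerLeft F Ind.yonedaCompInclusion) _).symm
    (isColimitOfPreserves (Ind.inclusion C) hc)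

lemma final_toArrow {c : Cocone (F ⋙ Ind.yoneda)} (hc : IsColimit c) : (toArrow c).Final := by
  let e : CostructuredArrow Ind.yoneda c.pt ≌
      CostructuredArrow yoneda ((Ind.inclusion C).obj c.pt) :=
    (CostructuredArrow.post Ind.yoneda (Ind.inclusion C) c.pt).asEquivalence.trans
      (CostructuredArrow.mapNatIso Ind.yonedaCompInclusion)
  let P := IndObjectPresentation.ofCocone _ (isColimitPresheafCocone hc)
  have h : (toArrow c ⋙ e.functor).Final :=
    Functor.final_of_natIso (F := P.toCostructuredArrow)
      (NatIso.ofComponents (fun i => CostructuredArrow.isoMk (Iso.refl _) (by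
        refine (congrArg (· ≫ _) (yoneda.map_id _)).trans ((Category.id_comp _).trans ?_)
        rfl)) (by
        intro i j f
        ext
        exact (Category.comp_id _).trans (Category.id_comp _).symm))
  exact (Functor.final_iff_comp_equivalence (toArrow c) e.functor).2 h

/-- The cocone obtained by applying a left Kan extension along `C ⥤ Ind C`. -/
def lanCocone (G : C ⥤ Ind C) (c : Cocone (F ⋙ Ind.yoneda)) : Cocone (F ⋙ G) where
  pt := (Ind.yoneda.lan.obj G).obj c.pt
  ι :=
    { app := fun i => (Ind.yoneda.lanUnit.app G).app (F.obj i) ≫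
        (Ind.yoneda.lan.obj G).map (c.ι.app i)
      naturality := fun i j f => by
        have h1 := (Ind.yoneda.lanUnit.app G).naturality (F.map f)
        have h2 := c.w f
        simp only [Functor.comp_map, Functor.id_obj, Functor.const_obj_obj, Functor.const_obj_map,
          Category.comp_id] at h1 h2 ⊢
        rw [← h2, Functor.map_comp, reassoc_of% h1]
        rfl }

/-- Left Kan extensions along `C ⥤ Ind C` preserve filtered colimits of objects of `C`. -/
def isColimitLanCocone (G : C ⥤ Ind C) {c : Cocone (F ⋙ Ind.yoneda)} (hc : IsColimit c) :
    IsColimit (lanCocone G c) :=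
  have := final_toArrow hc
  (Functor.Final.isColimitWhiskerEquiv (toArrow c) _).symm
    (Ind.yoneda.isPointwiseLeftKanExtensionLeftKanExtensionUnit G c.pt)

end Colimit


lemma lanCocone_naturality {I : Type v} [SmallCategory I] [IsFiltered I] (G : C ⥤ Ind C)
    {F F' : I ⥤ C} (α : F ⟶ F') {c : Cocone (F ⋙ Ind.yoneda)} {c' : Cocone (F' ⋙ Ind.yoneda)}
    (φ : c.pt ⟶ c'.pt) (i : I) (hφ : c.ι.app i ≫ φ = Ind.yoneda.map (α.app i) ≫ c'.ι.app i) :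
    (lanCocone G c).ι.app i ≫ (Ind.yoneda.lan.obj G).map φ =
      G.map (α.app i) ≫ (lanCocone G c').ι.app i := by
  have h3 := (Ind.yoneda.lanUnit.app G).naturality (α.app i)
  have h4 : (Ind.yoneda.lan.obj G).map (c.ι.app i) ≫ (Ind.yoneda.lan.obj G).map φ =
      (Ind.yoneda.lan.obj G).map (Ind.yoneda.map (α.app i)) ≫
        (Ind.yoneda.lan.obj G).map (c'.ι.app i) := by
    rw [← Functor.map_comp, ← Functor.map_comp]
    exact congrArg _ hφ
  refine (Category.assoc _ _ _).trans ?_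
  refine (congrArg (_ ≫ ·) h4).trans ?_
  refine (Category.assoc _ _ _).symm.trans ?_
  refine (congrArg (· ≫ _) h3.symm).trans ?_
  exact Category.assoc _ _ _

/-- Left Kan extensions along `C ⥤ Ind C` commute with formation of ind-objects. -/
def limCompLan (G : C ⥤ Ind C) (I : Type v) [SmallCategory I] [IsFiltered I] :
    Ind.lim I ⋙ Ind.yoneda.lan.obj G ≅ (Functor.whiskeringRight I C (Ind C)).obj G ⋙ colim :=
  isoOfIsColimit ((Functor.whiskeringRight I C (Ind C)).obj G)
    (fun F => (lanCocone G (colimit.cocone (F ⋙ Ind.yoneda))).ι)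
    (fun F => isColimitLanCocone G (colimit.isColimit (F ⋙ Ind.yoneda)))
    (fun F => (colimit.cocone (F ⋙ G)).ι)
    (fun F => colimit.isColimit (F ⋙ G))
    (fun {F F'} α i => lanCocone_naturality G α (c := colimit.cocone (F ⋙ Ind.yoneda))
      (c' := colimit.cocone (F' ⋙ Ind.yoneda)) ((Ind.lim I).map α) i (ι_colimMap _ _))
    (fun _ _ => ι_colimMap _ _)

/-- Filtered colimits of ind-objects commute with finite limits. -/
instance preservesLimitsOfShape_colim {α : Type} [SmallCategory α] [FinCategory α]
    [HasLimitsOfShape α C] [HasLimitsOfShape α (Ind C)]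
    [PreservesLimitsOfShape α (Ind.inclusion C)] {I : Type v}
    [SmallCategory I] [IsFiltered I] :
    PreservesLimitsOfShape α (colim : (I ⥤ Ind C) ⥤ Ind C) :=
  have : PreservesLimitsOfShape α ((colim : (I ⥤ Ind C) ⥤ Ind C) ⋙ Ind.inclusion C) :=
    preservesLimitsOfShape_of_natIso
      (F := (Functor.whiskeringRight I _ _).obj (Ind.inclusion C) ⋙ colim)
      (preservesColimitNatIso _).symm
  preservesLimitsOfShape_of_reflects_of_preserves _ (Ind.inclusion C)

/-- The left Kan extension along `C ⥤ Ind C` of a functor that preserves equalizers preserves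
equalizers. -/
lemma preservesEqualizers_lan [HasEqualizers C] (G : C ⥤ Ind C)
    [PreservesLimitsOfShape WalkingParallelPair G] :
    PreservesLimitsOfShape WalkingParallelPair (Ind.yoneda.lan.obj G) where
  preservesLimit {K} := by
    obtain ⟨P⟩ := nonempty_indParallelPairPresentation (Ind.isIndObject_inclusion_obj _)
      (Ind.isIndObject_inclusion_obj _)
      ((Ind.inclusion _).map (K.map WalkingParallelPairHom.left))
      ((Ind.inclusion _).map (K.map WalkingParallelPairHom.right))
    let e : parallelPair P.φ P.ψ ⋙ Ind.lim P.I ≅ K :=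
      (diagramIsoParallelPair _ ≪≫ P.parallelPairIsoParallelPairCompIndYoneda).symm
    have : PreservesLimitsOfShape WalkingParallelPair
        (Ind.lim P.I ⋙ Ind.yoneda.lan.obj G) :=
      preservesLimitsOfShape_of_natIso (limCompLan G P.I).symm
    have h : PreservesLimit (parallelPair P.φ P.ψ ⋙ Ind.lim P.I) (Ind.yoneda.lan.obj G) :=
      preservesLimit_of_preserves_limit_cone
        (isLimitOfPreserves (Ind.lim P.I) (limit.isLimit (parallelPair P.φ P.ψ)))
        (isLimitOfPreserves (Ind.lim P.I ⋙ Ind.yoneda.lan.obj G)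
          (limit.isLimit (parallelPair P.φ P.ψ)))
    exact preservesLimit_of_iso_diagram _ e

section ext

variable {I : Type v} [SmallCategory I] {F : I ⥤ C}

/-- The extension of a functor to ind-objects commutes with formation of ind-objects. -/
def extCocone (T : C ⥤ C) (c : Cocone (F ⋙ Ind.yoneda)) : Cocone ((F ⋙ T) ⋙ Ind.yoneda) :=
  lanCocone (T ⋙ Ind.yoneda) c

lemma extCocone_ι_map {T T' : C ⥤ C} (α : T ⟶ T') (c : Cocone (F ⋙ Ind.yoneda)) (i : I) :
    (extCocone T c).ι.app i ≫ (ext.map α).app c.pt =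
      Ind.yoneda.map (α.app (F.obj i)) ≫ (extCocone T' c).ι.app i := by
  have h1 := (ext.map α).naturality (c.ι.app i)
  have h2 := congr_app (Ind.yoneda.lanUnit.naturality (Functor.whiskerRight α Ind.yoneda))
    (F.obj i)
  refine (Category.assoc _ _ _).trans ?_
  refine (congrArg (_ ≫ ·) h1).trans ?_
  refine (Category.assoc _ _ _).symm.trans ?_
  refine (congrArg (· ≫ _) h2.symm).trans ?_
  exact Category.assoc _ _ _

variable [IsFiltered I]

/-- The cocone `extCocone T c` is a colimit cocone. -/
def isColimitExtCocone (T : C ⥤ C) {c : Cocone (F ⋙ Ind.yoneda)} (hc : IsColimit c) :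
    IsColimit (extCocone T c) :=
  isColimitLanCocone (T ⋙ Ind.yoneda) hc

lemma isIso_ext_map_app {T T' : C ⥤ C} (α : T ⟶ T') {c : Cocone (F ⋙ Ind.yoneda)}
    (hc : IsColimit c) (S : I → I) (s : ∀ i, i ⟶ S i)
    (β : ∀ i, T'.obj (F.obj i) ⟶ T.obj (F.obj (S i)))
    (h₁ : ∀ i, β i ≫ α.app (F.obj (S i)) = T'.map (F.map (s i)))
    (h₂ : ∀ i, α.app (F.obj i) ≫ β i = T.map (F.map (s i))) :
    IsIso ((ext.map α).app c.pt) :=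
  isIso_of_isColimit (isColimitExtCocone T hc) (isColimitExtCocone T' hc)
    (Functor.whiskerRight (Functor.whiskerLeft F α) Ind.yoneda) _ (extCocone_ι_map α c) S s
    (fun i => Ind.yoneda.map (β i))
    (fun i => (Ind.yoneda.map_comp _ _).symm.trans (congrArg Ind.yoneda.map (h₁ i)))
    (fun i => (Ind.yoneda.map_comp _ _).symm.trans (congrArg Ind.yoneda.map (h₂ i)))

/-- If `F ⋙ (T(A, -))` preserves equalizers in `A` termwise, then so does the extension of
`T(A, -)` evaluated at `"colim" F`. -/
lemma preservesEqualizers_ext_obj [HasEqualizers C] (T : C ⥤ C ⥤ C)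
    {c : Cocone (F ⋙ Ind.yoneda)} (hc : IsColimit c)
    (h : ∀ i, PreservesLimitsOfShape WalkingParallelPair (T.flip.obj (F.obj i))) :
    PreservesLimitsOfShape WalkingParallelPair ((T ⋙ ext).flip.obj c.pt) := by
  let H : C ⥤ (I ⥤ C) := T ⋙ (Functor.whiskeringLeft I C C).obj F
  have : PreservesLimitsOfShape WalkingParallelPair H :=
    preservesLimitsOfShape_of_evaluation _ _ fun i => h i
  let e : H ⋙ Ind.lim I ≅ (T ⋙ ext).flip.obj c.pt :=
    isoOfIsColimit (H ⋙ (Functor.whiskeringRight I C (Ind C)).obj Ind.yoneda)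
      (fun A => (colimit.cocone ((F ⋙ T.obj A) ⋙ Ind.yoneda)).ι)
      (fun A => colimit.isColimit ((F ⋙ T.obj A) ⋙ Ind.yoneda))
      (fun A => (extCocone (T.obj A) c).ι)
      (fun A => isColimitExtCocone (T.obj A) hc)
      (fun _ _ => ι_colimMap _ _)
      (fun f i => extCocone_ι_map (T.map f) c i)
  exact preservesLimitsOfShape_of_natIso e

lemma preservesEqualizers_ext₂ [HasEqualizers C] (T : C ⥤ C ⥤ C)
    {c : Cocone (F ⋙ Ind.yoneda)} (hc : IsColimit c)
    (h : ∀ i, PreservesLimitsOfShape WalkingParallelPair (T.flip.obj (F.obj i))) :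
    PreservesLimitsOfShape WalkingParallelPair ((ext₂ T).flip.obj c.pt) :=
  have := preservesEqualizers_ext_obj T hc h
  preservesEqualizers_lan ((T ⋙ ext).flip.obj c.pt)

end ext

end IndExt

section StrictMono

variable {D : Type*} [Category* D] [HasZeroMorphisms D] [HasKernels D] [HasCokernels D]

lemma isIso_coimage_π {X Y : D} (f : X ⟶ Y) [Mono f] : IsIso (Abelian.coimage.π f) := by
  have h : kernel.ι f = 0 := by rw [← cancel_mono f, kernel.condition, zero_comp]
  refine ⟨cokernel.desc _ (𝟙 X) (by rw [h, zero_comp]), cokernel.π_desc _ _ _, ?_⟩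
  rw [← cancel_epi (cokernel.π (kernel.ι f)), cokernel.π_desc_assoc, Category.id_comp,
    Category.comp_id]

/-- A kernel is a monomorphism whose coimage agrees with its image. -/
lemma mono_and_isIso_coimageImageComparison {X Y Z : D} {f : X ⟶ Y} {g : Y ⟶ Z} {w : f ≫ g = 0}
    (h : IsLimit (KernelFork.ofι f w)) : Mono f ∧ IsIso (Abelian.coimageImageComparison f) := by
  have hf : Mono f := mono_of_isLimit_fork h
  refine ⟨hf, ?_⟩
  obtain ⟨l, hl⟩ := KernelFork.IsLimit.lift' h (Abelian.image.ι f) (by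
    rw [← cokernel.π_desc f g w, kernel.condition_assoc, zero_comp])
  replace hl : l ≫ f = Abelian.image.ι f := hl
  have hi := isIso_coimage_π f
  have h1 := Abelian.coimage_image_factorisation f
  have h2 : (Abelian.coimage.π f ≫ Abelian.coimageImageComparison f) ≫ l = 𝟙 X := by
    rw [← cancel_mono f, Category.assoc, hl, Category.assoc, h1, Category.id_comp]
  have h3 : l ≫ Abelian.coimage.π f ≫ Abelian.coimageImageComparison f = 𝟙 _ := by
    rw [← cancel_mono (Abelian.image.ι f), Category.assoc, Category.assoc, h1, hl,
      Category.id_comp]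
  have : IsIso (Abelian.coimage.π f ≫ Abelian.coimageImageComparison f) := ⟨l, h2, h3⟩
  exact IsIso.of_isIso_comp_left (Abelian.coimage.π f) _

/-- A monomorphism whose coimage agrees with its image is a kernel of its cokernel. -/
def isLimitOfIsIsoCoimageImageComparison {X Y : D} (f : X ⟶ Y) [Mono f]
    [IsIso (Abelian.coimageImageComparison f)] :
    IsLimit (KernelFork.ofι f (cokernel.condition f)) :=
  have hi := isIso_coimage_π f
  let e : X ≅ Abelian.image f :=
    asIso (Abelian.coimage.π f) ≪≫ asIso (Abelian.coimageImageComparison f)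
  IsLimit.ofIsoLimit (kernelIsKernel (cokernel.π f)) (Fork.ext e.symm (by
    rw [Iso.symm_hom, Iso.inv_comp_eq]
    simp [e]))

end StrictMono

namespace IndExt

variable {C : Type u} [Category.{v} C] [HasZeroMorphisms (Ind C)]

lemma isZero_ext_obj {I : Type v} [SmallCategory I] [IsFiltered I] {F : I ⥤ C}
    (T : C ⥤ C) {c : Cocone (F ⋙ Ind.yoneda)} (hc : IsColimit c)
    (h : ∀ i, IsZero (Ind.yoneda.obj (T.obj (F.obj i)))) : IsZero ((ext.obj T).obj c.pt) :=
  (IsZero.iff_id_eq_zero _).2 ((isColimitExtCocone T hc).hom_ext fun i =>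
    IsZero.eq_of_src (h i) _ _)

end IndExt

namespace IndBan

variable {R : Type u} [BanachRing R]

lemma isFlat_of_preservesEqualizers (V : Ind (BanMod R))
    [PreservesLimitsOfShape WalkingParallelPair ((tensor R).flip.obj V)]
    [((tensor R).flip.obj V).PreservesZeroMorphisms] : IsFlat V := by
  rintro E F f ⟨hm, hi⟩
  have h := isLimitOfIsIsoCoimageImageComparison f
  exact mono_and_isIso_coimageImageComparison
    (isLimitForkMapOfIsLimit' ((tensor R).flip.obj V) (cokernel.condition f) h)

/-- An ind-object presented by objects `F i` such that `(-) ⊗̂ F i` preserves equalizers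
is flat. -/
theorem isFlat_of_isColimit {I : Type u} [SmallCategory I] [IsFiltered I] {F : I ⥤ BanMod R}
    {c : Cocone (F ⋙ Ind.yoneda)} (hc : IsColimit c)
    (h : ∀ i, PreservesLimitsOfShape WalkingParallelPair
      ((BanMod.tensorFunctor R).flip.obj (F.obj i))) : IsFlat c.pt := by
  have h1 : PreservesLimitsOfShape WalkingParallelPair ((tensor R).flip.obj c.pt) :=
    IndExt.preservesEqualizers_ext₂ _ hc h
  have h0 : ∀ M : BanMod R, IsZero (BanMod.tensor (BanMod.zero R) M) := fun M => by
    rw [IsZero.iff_id_eq_zero]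
    refine BanMod.tensor_hom_ext fun m n => ?_
    have : BanMod.tmul m n = 0 := LinearMap.map_zero₂ (BanMod.tmulBilin (BanMod.zero R) M) n
    rw [this, map_zero, map_zero]
  have hy : ∀ {M : BanMod R}, IsZero M → IsZero (Ind.yoneda.obj M) := fun {M} hM =>
    isZero_yoneda_zero.of_iso (Ind.yoneda.mapIso (hM.iso BanMod.isZero_zero))
  have hz : IsZero (((tensor R).flip.obj c.pt).obj (Ind.yoneda.obj (BanMod.zero R))) :=
    (IndExt.isZero_ext_obj _ hc fun i => hy (h0 _)).of_iso
      (IndExt.ext₂Iso (BanMod.tensorFunctor R) (BanMod.zero R) c.pt)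
  have h2 : ((tensor R).flip.obj c.pt).PreservesZeroMorphisms :=
    Functor.preservesZeroMorphisms_of_map_zero_object
      (((tensor R).flip.obj c.pt).mapIso (HasZeroObject.zeroIsoIsInitial
        (isZero_yoneda_zero (R := R)).isInitial) ≪≫ hz.isoZero)
  exact isFlat_of_preservesEqualizers c.pt

/-- A criterion for nuclearity of `"colim" F`. -/
theorem isNuclear_of_isColimit {I : Type u} [SmallCategory I] [IsFiltered I] {F : I ⥤ BanMod R}
    {c : Cocone (F ⋙ Ind.yoneda)} (hc : IsColimit c) (S : I → I) (s : ∀ i, i ⟶ S i)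
    (β : ∀ (W : BanMod R) (i : I),
      BanMod.ihom W (F.obj i) ⟶ BanMod.tensor (BanMod.dual W) (F.obj (S i)))
    (h₁ : ∀ W i, β W i ≫ BanMod.dualTensorHom W (F.obj (S i)) =
      (BanMod.ihomFunctor W).map (F.map (s i)))
    (h₂ : ∀ W i, BanMod.dualTensorHom W (F.obj i) ≫ β W i =
      BanMod.tensorMap (𝟙 _) (F.map (s i))) : IsNuclear c.pt := fun W =>
  have := IndExt.isIso_ext_map_app (BanMod.dualTensorHomNat W) hc S s (β W) (h₁ W) (h₂ W)
  IsIso.comp_isIso' (Iso.isIso_hom _) this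

end IndBan

namespace BanMod

variable {R : Type u} [BanachRing R]

/-! ### Weighted `ℓ¹`-modules -/

/-- Families of positive weights. -/
abbrev PosWeight (ι : Type) : Type := {w : ι → ℝ // ∀ i, 0 < w i}

section Ell1

variable {ι : Type}

/-- The families `x` in `A` with `∑ ‖x i‖ w i < ∞`. -/
def ell1Submodule (w : PosWeight ι) (A : BanMod R) : Submodule R (ι → A) where
  carrier := {x | Summable fun i => ‖x i‖ * w.1 i}
  zero_mem' := by simp
  add_mem' := by
    intro x y hx hy
    refine Summable.of_nonneg_of_le (fun i => mul_nonneg (norm_nonneg _) (w.2 i).le)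
      (fun i => ?_) (hx.add hy)
    rw [← add_mul]
    exact mul_le_mul_of_nonneg_right (norm_add_le _ _) (w.2 i).le
  smul_mem' := by
    intro a x hx
    obtain ⟨C, hC, h⟩ := A.exists_norm_smul_le
    refine Summable.of_nonneg_of_le (fun i => mul_nonneg (norm_nonneg _) (w.2 i).le)
      (fun i => ?_) (Summable.mul_left (C * ‖a‖) hx)
    rw [← mul_assoc]
    exact mul_le_mul_of_nonneg_right (h a _) (w.2 i).le

/-- The underlying module of the weighted `ℓ¹`-module. -/
def Ell1 (w : PosWeight ι) (A : BanMod R) : Type u := ell1Submodule w A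

namespace Ell1

variable {w : PosWeight ι} {A : BanMod R}

instance : AddCommGroup (Ell1 w A) := inferInstanceAs (AddCommGroup (ell1Submodule w A))

instance : Module R (Ell1 w A) := inferInstanceAs (Module R (ell1Submodule w A))

/-- The `i`-th term of a family. -/
def coord (i : ι) : Ell1 w A →ₗ[R] A := (LinearMap.proj i).comp (ell1Submodule w A).subtype

lemma ext {x y : Ell1 w A} (h : ∀ i, coord i x = coord i y) : x = y := Subtype.ext (funext h)

lemma summable (x : Ell1 w A) : Summable fun i => ‖coord i x‖ * w.1 i := x.2

lemma term_nonneg (x : Ell1 w A) (i : ι) : 0 ≤ ‖coord i x‖ * w.1 i :=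
  mul_nonneg (norm_nonneg _) (w.2 i).le

instance instNormedAddCommGroup : NormedAddCommGroup (Ell1 w A) :=
  AddGroupNorm.toNormedAddCommGroup
    { toFun := fun x => ∑' i, ‖coord i x‖ * w.1 i
      map_zero' := by simp
      add_le' := fun x y => by
        rw [← (summable x).tsum_add (summable y)]
        refine (summable (x + y)).tsum_le_tsum (fun i => ?_) ((summable x).add (summable y))
        rw [map_add, ← add_mul]
        exact mul_le_mul_of_nonneg_right (norm_add_le _ _) (w.2 i).le
      neg' := fun x => by simp
      eq_zero_of_map_eq_zero' := fun x hx => ext fun i => by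
        have h := ((summable x).hasSum_iff.2 hx)
        have h' := congrFun ((hasSum_zero_iff_of_nonneg (term_nonneg x)).1 h) i
        rw [Pi.zero_apply, mul_eq_zero, or_iff_left (w.2 i).ne', norm_eq_zero] at h'
        rw [h', map_zero] }

lemma norm_def (x : Ell1 w A) : ‖x‖ = ∑' i, ‖coord i x‖ * w.1 i := rfl

lemma norm_coord_mul_le (x : Ell1 w A) (i : ι) : ‖coord i x‖ * w.1 i ≤ ‖x‖ :=
  (summable x).le_tsum i fun k _ => term_nonneg x k

lemma norm_coord_le (x : Ell1 w A) (i : ι) : ‖coord i x‖ ≤ (w.1 i)⁻¹ * ‖x‖ := by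
  rw [← div_eq_inv_mul, le_div_iff₀ (w.2 i)]
  exact norm_coord_mul_le x i

lemma sum_le_norm (x : Ell1 w A) (s : Finset ι) : ∑ i ∈ s, ‖coord i x‖ * w.1 i ≤ ‖x‖ :=
  (summable x).sum_le_tsum s fun k _ => term_nonneg x k

lemma norm_le (x : Ell1 w A) {C : ℝ} (h : ∀ s : Finset ι, ∑ i ∈ s, ‖coord i x‖ * w.1 i ≤ C) :
    ‖x‖ ≤ C := (summable x).tsum_le_of_sum_le h

/-- The family with given terms. -/
def mk (x : ι → A) (h : Summable fun i => ‖x i‖ * w.1 i) : Ell1 w A := ⟨x, h⟩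

instance instCompleteSpace : CompleteSpace (Ell1 w A) := by
  refine Metric.complete_of_cauchySeq_tendsto fun u hu => ?_
  have hpt : ∀ i, CauchySeq fun k => coord i (u k) := fun i =>
    (AddMonoidHomClass.uniformContinuous_of_bound (coord (w := w) (A := A) i) (w.1 i)⁻¹
      fun x => norm_coord_le x i).comp_cauchySeq hu
  choose a ha using fun i => cauchySeq_tendsto_of_complete (hpt i)
  obtain ⟨B, hB⟩ := hu.norm_bddAbove
  have hB' : ∀ k, ‖u k‖ ≤ B := fun k => hB ⟨k, rfl⟩
  have hsum : Summable fun i => ‖a i‖ * w.1 i := by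
    refine summable_of_sum_le (c := B)
      (fun i => mul_nonneg (norm_nonneg _) (w.2 i).le) fun s => ?_
    refine le_of_tendsto (tendsto_finsetSum s fun i _ => (ha i).norm.mul_const (w.1 i))
      (Filter.Eventually.of_forall fun k => (sum_le_norm (u k) s).trans (hB' k))
  refine ⟨mk a hsum, ?_⟩
  rw [Metric.tendsto_atTop]
  intro ε hε
  rw [Metric.cauchySeq_iff] at hu
  obtain ⟨K, hK⟩ := hu (ε / 2) (half_pos hε)
  refine ⟨K, fun k hk => ?_⟩
  rw [dist_eq_norm]
  refine lt_of_le_of_lt (norm_le _ fun s => ?_) (half_lt_self hε)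
  have hlim : Filter.Tendsto (fun l => ∑ i ∈ s, ‖coord i (u k) - coord i (u l)‖ * w.1 i)
      Filter.atTop (nhds (∑ i ∈ s, ‖coord i (u k) - a i‖ * w.1 i)) :=
    tendsto_finsetSum s fun i _ =>
      ((tendsto_const_nhds.sub (ha i)).norm).mul_const (w.1 i)
  refine le_of_tendsto hlim (Filter.eventually_atTop.2 ⟨K, fun l hl => ?_⟩)
  have h1 := hK k hk l hl
  rw [dist_eq_norm] at h1
  refine le_trans ?_ ((sum_le_norm (u k - u l) s).trans h1.le)
  exact le_of_eq (Finset.sum_congr rfl fun i _ => by rw [map_sub])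

end Ell1

/-- The Banach module of families `x` in `A` with norm `∑ ‖x i‖ w i < ∞`. -/
def ell1 (w : PosWeight ι) (A : BanMod R) : BanMod R where
  carrier := Ell1 w A
  exists_norm_smul_le := by
    obtain ⟨C, hC, h⟩ := A.exists_norm_smul_le
    refine ⟨C, hC, fun a x => ?_⟩
    rw [Ell1.norm_def, Ell1.norm_def, ← tsum_mul_left]
    refine (Ell1.summable (a • x)).tsum_le_tsum (fun i => ?_) ((Ell1.summable x).mul_left _)
    rw [← mul_assoc]
    exact mul_le_mul_of_nonneg_right (h a _) (w.2 i).le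

namespace ell1

variable {w : PosWeight ι} {A : BanMod R}

/-- The `i`-th term of a family. -/
def coord (i : ι) : ell1 w A →ₗ[R] A := Ell1.coord i

lemma ext {x y : ell1 w A} (h : ∀ i, coord i x = coord i y) : x = y := Ell1.ext h

lemma summable (x : ell1 w A) : Summable fun i => ‖coord i x‖ * w.1 i := Ell1.summable x

lemma norm_def (x : ell1 w A) : ‖x‖ = ∑' i, ‖coord i x‖ * w.1 i := rfl

lemma norm_coord_le (x : ell1 w A) (i : ι) : ‖coord i x‖ ≤ (w.1 i)⁻¹ * ‖x‖ :=
  Ell1.norm_coord_le x i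

lemma sum_le_norm (x : ell1 w A) (s : Finset ι) : ∑ i ∈ s, ‖coord i x‖ * w.1 i ≤ ‖x‖ :=
  Ell1.sum_le_norm x s

lemma norm_le (x : ell1 w A) {C : ℝ} (h : ∀ s : Finset ι, ∑ i ∈ s, ‖coord i x‖ * w.1 i ≤ C) :
    ‖x‖ ≤ C := Ell1.norm_le x h

/-- The bounded map to `ℓ¹(w, A)` with given terms. -/
def lift {M : BanMod R} (φ : M →ₗ[R] (ι → A))
    (h : ∃ C : ℝ, ∀ m (s : Finset ι), ∑ i ∈ s, ‖φ m i‖ * w.1 i ≤ C * ‖m‖) : M ⟶ ell1 w A :=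
  mkHom (N := ell1 w A) (φ.codRestrict (ell1Submodule w A) fun m => by
    obtain ⟨C, h⟩ := h
    exact summable_of_sum_le (fun i => mul_nonneg (norm_nonneg _) (w.2 i).le) (h m))
    (by
      obtain ⟨C, h⟩ := h
      exact ⟨C, fun m => norm_le _ (h m)⟩)

lemma coord_lift {M : BanMod R} (φ : M →ₗ[R] (ι → A))
    (h : ∃ C : ℝ, ∀ m (s : Finset ι), ∑ i ∈ s, ‖φ m i‖ * w.1 i ≤ C * ‖m‖) (m : M) (i : ι) :
    coord i ((hom (lift (w := w) φ h)).1 m) = φ m i := rfl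

lemma hom_ext' {M : BanMod R} {f g : M ⟶ ell1 w A}
    (h : ∀ m i, coord i ((hom f).1 m) = coord i ((hom g).1 m)) : f = g :=
  hom_ext fun m => ext (h m)

lemma continuous_coord (i : ι) : Continuous (coord i : ell1 w A → A) :=
  AddMonoidHomClass.continuous_of_bound (coord i : ell1 w A →ₗ[R] A) _ fun x => norm_coord_le x i

open Classical in
/-- The family with only one nonzero term. -/
def single (i : ι) : A ⟶ ell1 w A :=
  lift (LinearMap.single R (fun _ => A) i) ⟨w.1 i, fun a s => by
    have : ∀ j ∈ s, ‖LinearMap.single R (fun _ : ι => (A : Type u)) i a j‖ * w.1 j =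
        if j = i then w.1 i * ‖a‖ else 0 := by
      intro j _
      by_cases hj : j = i
      · subst hj; simp [mul_comm]
      · simp [hj]
    rw [Finset.sum_congr rfl this, Finset.sum_ite_eq']
    split_ifs
    · exact le_rfl
    · exact mul_nonneg (w.2 i).le (norm_nonneg _)⟩

lemma coord_single_self (i : ι) (a : A) : coord i ((hom (single (w := w) i)).1 a) = a := by
  classical
  refine (coord_lift _ _ _ _).trans ?_
  simp

lemma coord_single_of_ne {i j : ι} (h : j ≠ i) (a : A) :
    coord j ((hom (single (w := w) i)).1 a) = 0 := by
  classical
  refine (coord_lift _ _ _ _).trans ?_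
  simp [h]

lemma norm_single_le (i : ι) (a : A) : ‖(hom (single (w := w) i)).1 a‖ ≤ w.1 i * ‖a‖ := by
  classical
  refine norm_le _ fun s => ?_
  have : ∀ j ∈ s, ‖coord j ((hom (single (w := w) i)).1 a)‖ * w.1 j =
      if j = i then w.1 i * ‖a‖ else 0 := by
    intro j _
    by_cases hj : j = i
    · subst hj; rw [coord_single_self, if_pos rfl, mul_comm]
    · rw [coord_single_of_ne hj, norm_zero, zero_mul, if_neg hj]
  rw [Finset.sum_congr rfl this, Finset.sum_ite_eq']
  split_ifs
  · exact le_rfl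
  · exact mul_nonneg (w.2 i).le (norm_nonneg _)

lemma hasSum_single_coord (x : ell1 w A) :
    HasSum (fun i => (hom (single (w := w) i)).1 (coord i x)) x := by
  have hs : Summable fun i => (hom (single (w := w) i)).1 (coord i x) :=
    Summable.of_norm_bounded (summable x) fun i =>
      (norm_single_le i _).trans_eq (mul_comm _ _)
  convert hs.hasSum using 1
  refine ext fun i => ?_
  have h1 := (hs.hasSum.map (coord i : ell1 w A →ₗ[R] A) (continuous_coord i))
  have h2 := _root_.hasSum_single i
    (f := fun j => coord i ((hom (single (w := w) j)).1 (coord j x)))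
    fun j hj => coord_single_of_ne (Ne.symm hj) _
  rw [coord_single_self] at h2
  exact h2.unique h1

lemma hom_ext_single {P : BanMod R} {f g : ell1 w A ⟶ P} (h : ∀ i, single i ≫ f = single i ≫ g) :
    f = g := by
  refine hom_ext fun x => ?_
  have h1 := (hasSum_single_coord x).map (hom f).1 (hom f).1.continuous
  have h2 := (hasSum_single_coord x).map (hom g).1 (hom g).1.continuous
  refine h1.unique ?_
  convert h2 using 1
  funext i
  exact congrArg (fun k => (hom k).1 (coord i x)) (h i)

/-- The bounded map `x ↦ ∑ gᵢ(xᵢ)` out of `ℓ¹(w, A)`. -/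
def desc {P : BanMod R} (g : ι → (A →ₗ[R] P)) {C : ℝ} (h : ∀ i a, ‖g i a‖ ≤ C * (‖a‖ * w.1 i)) :
    ell1 w A ⟶ P :=
  have hs : ∀ x : ell1 w A, Summable fun i => g i (coord i x) := fun x =>
    Summable.of_norm_bounded ((summable x).mul_left C) fun i => h i _
  mkHom
    { toFun := fun x => ∑' i, g i (coord i x)
      map_add' := fun x y => by
        simp only [map_add]
        exact (hs x).tsum_add (hs y)
      map_smul' := fun a x => by
        obtain ⟨K, hK, hb⟩ := P.exists_norm_smul_le
        have hc : Continuous (DistribSMul.toAddMonoidHom P a : P →+ P) :=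
          AddMonoidHomClass.continuous_of_bound
            (DistribSMul.toAddMonoidHom P a : P →+ P) (K * ‖a‖) (hb a)
        simp only [map_smul, RingHom.id_apply]
        exact ((hs x).hasSum.map (DistribSMul.toAddMonoidHom P a : P →+ P) hc).tsum_eq }
    ⟨C, fun x => by
      rw [norm_def, ← tsum_mul_left]
      exact tsum_of_norm_bounded ((summable x).mul_left C).hasSum fun i => h i _⟩

lemma single_desc {P : BanMod R} (g : ι → (A →ₗ[R] P)) {C : ℝ}
    (h : ∀ i a, ‖g i a‖ ≤ C * (‖a‖ * w.1 i)) (i : ι) (a : A) :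
    (hom (desc g h)).1 ((hom (single (w := w) i)).1 a) = g i a := by
  refine (tsum_eq_single i fun j hj => ?_).trans ?_
  · rw [coord_single_of_ne hj, map_zero]
  · rw [coord_single_self]

/-- Functoriality of `ℓ¹(w, A)` in `A`. -/
def map (w : PosWeight ι) {A B : BanMod R} (f : A ⟶ B) : ell1 w A ⟶ ell1 w B :=
  lift (LinearMap.pi fun i => (toLin f).comp (coord i)) ⟨‖(hom f).1‖, fun x s => by
    refine le_trans ?_ (mul_le_mul_of_nonneg_left (sum_le_norm x s) (norm_nonneg _))
    rw [Finset.mul_sum]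
    refine Finset.sum_le_sum fun i _ => ?_
    rw [← mul_assoc]
    exact mul_le_mul_of_nonneg_right ((hom f).1.le_opNorm _) (w.2 i).le⟩

/-- The restriction map `ℓ¹(w, A) ⟶ ℓ¹(w', A)` for `w' = O(w)`. -/
def restrict {w w' : PosWeight ι} (A : BanMod R) (h : ∃ C : ℝ, ∀ i, w'.1 i ≤ C * w.1 i) :
    ell1 w A ⟶ ell1 w' A :=
  lift (LinearMap.pi fun i => coord i) (by
    obtain ⟨C, h⟩ := h
    refine ⟨max C 0, fun x s => ?_⟩
    refine le_trans ?_ (mul_le_mul_of_nonneg_left (sum_le_norm x s) (le_max_right C 0))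
    rw [Finset.mul_sum]
    refine Finset.sum_le_sum fun i _ => ?_
    rw [mul_left_comm]
    exact mul_le_mul_of_nonneg_left ((h i).trans
      (mul_le_mul_of_nonneg_right (le_max_left C 0) (w.2 i).le)) (norm_nonneg _))

lemma coord_restrict {w w' : PosWeight ι} (h : ∃ C : ℝ, ∀ i, w'.1 i ≤ C * w.1 i)
    (x : ell1 w A) (i : ι) : coord i ((hom (restrict A h)).1 x) = coord i x :=
  coord_lift (LinearMap.pi fun i => coord i) _ x i

end ell1

/-- The functor `A ↦ ℓ¹(w, A)`. -/
def ell1Functor (R : Type u) [BanachRing R] (w : PosWeight ι) : BanMod R ⥤ BanMod R where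
  obj A := ell1 w A
  map f := ell1.map w f
  map_id _ := rfl
  map_comp _ _ := rfl

end Ell1

end BanMod

namespace BanMod

variable {R : Type u} [BanachRing R]

/-! ### Equalizers of Banach modules -/

section Equalizer

variable {E A B : BanMod R} {f g : A ⟶ B}

/-- An isometric map onto the locus where `f` and `g` agree is an equalizer. -/
def isLimitFork (j : E ⟶ A) (w : j ≫ f = j ≫ g) (hj : ∀ e, ‖(hom j).1 e‖ = ‖e‖)
    (hs : ∀ a, (hom f).1 a = (hom g).1 a → ∃ e, (hom j).1 e = a) : IsLimit (Fork.ofι j w) :=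
  have inj : Function.Injective (hom j).1 := (injective_iff_map_eq_zero (hom j).1).2 fun e he => by
    rw [← norm_eq_zero, ← hj, he, norm_zero]
  have hk : ∀ s : Fork f g, ∃ l : s.pt ⟶ E, l ≫ j = s.ι := fun s => by
    choose l hl using fun z => hs ((hom s.ι).1 z)
      (congrArg (fun k => (hom k).1 z) s.condition)
    refine ⟨mkHom { toFun := l, map_add' := fun x y => inj ?_, map_smul' := fun a x => inj ?_ }
      ⟨‖(hom s.ι).1‖, fun z => ?_⟩, hom_ext hl⟩
    · rw [hl, map_add, map_add, hl, hl]
    · rw [hl, (hom s.ι).2]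
      exact ((hom j).2 a (l x)).symm ▸ (congrArg (a • ·) (hl x)).symm
    · refine (hj (l z)).symm.le.trans ?_
      rw [hl]
      exact (hom s.ι).1.le_opNorm z
  Fork.IsLimit.mk _ (fun s => (hk s).choose) (fun s => (hk s).choose_spec) fun s m hm =>
    hom_ext fun z => inj (congrArg (fun k => (hom k).1 z) (hm.trans (hk s).choose_spec.symm))

/-- The submodule where two morphisms agree. -/
def eqLocus (f g : A ⟶ B) : BanMod R :=
  ofClosed (LinearMap.ker (toLin (f - g))) (isClosed_ker (f - g))

/-- The inclusion of the submodule where two morphisms agree. -/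
def eqLocusι (f g : A ⟶ B) : eqLocus f g ⟶ A :=
  mkHom (M := eqLocus f g) (LinearMap.ker (toLin (f - g))).subtype
    ⟨1, fun m => by rw [one_mul]; exact le_rfl⟩

lemma norm_eqLocusι (e : eqLocus f g) : ‖(hom (eqLocusι f g)).1 e‖ = ‖e‖ := rfl

lemma eqLocusι_condition (f g : A ⟶ B) : eqLocusι f g ≫ f = eqLocusι f g ≫ g :=
  hom_ext fun e => sub_eq_zero.1 e.2

lemma exists_eqLocusι_eq (a : A) (h : (hom f).1 a = (hom g).1 a) :
    ∃ e, (hom (eqLocusι f g)).1 e = a := ⟨⟨a, sub_eq_zero.2 h⟩, rfl⟩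

/-- The inclusion of the submodule where two morphisms agree is their equalizer. -/
def isLimitEqLocus (f g : A ⟶ B) : IsLimit (Fork.ofι (eqLocusι f g) (eqLocusι_condition f g)) :=
  isLimitFork _ _ norm_eqLocusι exists_eqLocusι_eq

lemma preservesEqualizers_of_eqLocus (G : BanMod R ⥤ BanMod R)
    (h : ∀ {A B : BanMod R} (f g : A ⟶ B), ∃ w : G.map (eqLocusι f g) ≫ G.map f =
      G.map (eqLocusι f g) ≫ G.map g, Nonempty (IsLimit (Fork.ofι (G.map (eqLocusι f g)) w))) :
    PreservesLimitsOfShape WalkingParallelPair G where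
  preservesLimit {K} := by
    have (A B : BanMod R) (f g : A ⟶ B) : PreservesLimit (parallelPair f g) G := by
      obtain ⟨w, ⟨hl⟩⟩ := h f g
      exact preservesLimit_of_preserves_limit_cone (isLimitEqLocus f g)
        ((isLimitMapConeForkEquiv G (eqLocusι_condition f g)).symm hl)
    exact preservesLimit_of_iso_diagram G (diagramIsoParallelPair K).symm

end Equalizer

section Ell1

variable {ι : Type} {w : PosWeight ι}

namespace ell1

instance preservesEqualizers : PreservesLimitsOfShape WalkingParallelPair (ell1Functor R w) :=
  preservesEqualizers_of_eqLocus _ fun {A B} f g =>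
    ⟨by rw [← Functor.map_comp, ← Functor.map_comp, eqLocusι_condition],
      ⟨isLimitFork _ _ (fun _ => rfl) fun a ha => by
        have h : ∀ i, (hom f).1 (coord i a) = (hom g).1 (coord i a) := fun i =>
          congrArg (coord i) ha
        choose e he using fun i => exists_eqLocusι_eq (coord i a) (h i)
        refine ⟨Ell1.mk e ?_, ext he⟩
        refine (summable a).congr fun i => ?_
        rw [← he i, norm_eqLocusι]⟩⟩

/-- An element of the unit object as a scalar. -/
def scalar (r : unit R) : R := r

lemma exists_sum_norm_smul_le (w : PosWeight ι) (A : BanMod R) : ∃ C : ℝ, 0 ≤ C ∧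
    ∀ (a : A) (x : ell1 w (unit R)) (s : Finset ι),
      ∑ i ∈ s, ‖scalar (coord i x) • a‖ * w.1 i ≤ C * (‖a‖ * ‖x‖) := by
  obtain ⟨C, hC, h⟩ := A.exists_norm_smul_le
  refine ⟨C, hC.le, fun a x s => ?_⟩
  rw [← mul_assoc]
  refine le_trans ?_ (mul_le_mul_of_nonneg_left (sum_le_norm x s) (by positivity))
  rw [Finset.mul_sum]
  refine Finset.sum_le_sum fun i _ => ?_
  rw [← mul_assoc]
  exact mul_le_mul_of_nonneg_right ((h _ a).trans_eq (mul_right_comm _ _ _)) (w.2 i).le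

lemma summable_norm_smul (w : PosWeight ι) (A : BanMod R) (a : A) (x : ell1 w (unit R)) :
    Summable fun i => ‖scalar (coord i x) • a‖ * w.1 i :=
  summable_of_sum_le (fun i => mul_nonneg (norm_nonneg _) (w.2 i).le)
    ((exists_sum_norm_smul_le w A).choose_spec.2 a x)

/-- The bilinear map `(a, x) ↦ (xᵢ a)ᵢ`. -/
def smulBilin (w : PosWeight ι) (A : BanMod R) : A →ₗ[R] ell1 w (unit R) →ₗ[R] ell1 w A :=
  LinearMap.mk₂ R
    (fun a x => Ell1.mk (fun i => scalar (coord i x) • a) (summable_norm_smul w A a x))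
    (fun _ _ _ => ext fun _ => smul_add _ _ _)
    (fun _ _ _ => ext fun _ => smul_comm _ _ _)
    (fun _ _ _ => ext fun _ => add_smul _ _ _)
    (fun _ _ _ => ext fun _ => mul_smul _ _ _)

/-- The natural map `A ⊗̂ ℓ¹(w, R) ⟶ ℓ¹(w, A)`. -/
def ofTensor (w : PosWeight ι) (A : BanMod R) : tensor A (ell1 w (unit R)) ⟶ ell1 w A :=
  tensorLift (smulBilin w A) ((exists_sum_norm_smul_le w A).imp fun _ h =>
    ⟨h.1, fun a x => norm_le _ (h.2 a x)⟩)

lemma coord_ofTensor_tmul (A : BanMod R) (a : A) (x : ell1 w (unit R)) (i : ι) :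
    coord i ((hom (ofTensor w A)).1 (tmul a x)) = scalar (coord i x) • a :=
  congrArg (coord i) (tensorLift_tmul (smulBilin w A) _ a x)

/-- The unit vectors of `ℓ¹(w, R)`. -/
def basis (w : PosWeight ι) (i : ι) : ell1 w (unit R) :=
  (hom (single i)).1 (show unit R from (1 : R))

/-- The natural map `ℓ¹(w, A) ⟶ A ⊗̂ ℓ¹(w, R)`. -/
def toTensor (w : PosWeight ι) (A : BanMod R) : ell1 w A ⟶ tensor A (ell1 w (unit R)) :=
  desc (C := ‖(1 : R)‖) (fun i => (tmulBilin A (ell1 w (unit R))).flip (basis w i)) fun i a => by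
    refine (norm_tmul_le a (basis w i)).trans ?_
    rw [mul_left_comm]
    exact mul_le_mul_of_nonneg_left ((norm_single_le i _).trans_eq (mul_comm _ _)) (norm_nonneg _)

lemma toTensor_single (A : BanMod R) (i : ι) (a : A) :
    (hom (toTensor w A)).1 ((hom (single i)).1 a) = tmul a (basis w i) :=
  single_desc _ _ i a

lemma toTensor_ofTensor (A : BanMod R) : toTensor w A ≫ ofTensor w A = 𝟙 _ := by
  refine hom_ext_single fun i => hom_ext fun a => ext fun j => ?_
  have h := congrArg (fun t => coord j ((hom (ofTensor w A)).1 t)) (toTensor_single A i a)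
  refine h.trans ((coord_ofTensor_tmul A a (basis w i) j).trans ?_)
  by_cases hj : j = i
  · subst hj
    have : coord j (basis w j) = (show unit R from (1 : R)) := coord_single_self (w := w) j _
    rw [this]
    exact (one_smul R a).trans (coord_single_self j a).symm
  · have : coord j (basis (R := R) w i) = 0 := coord_single_of_ne (w := w) hj _
    rw [this]
    exact (zero_smul R a).trans (coord_single_of_ne hj a).symm

/-- The bounded map `x ↦ a ⊗ x`. -/
def tmulLeft {A B : BanMod R} (a : A) : B ⟶ tensor A B :=
  mkHom (tmulBilin A B a) ⟨‖a‖, fun b => norm_tmul_le a b⟩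

lemma ofTensor_toTensor (A : BanMod R) : ofTensor w A ≫ toTensor w A = 𝟙 _ := by
  refine tensor_hom_ext fun a x => ?_
  have key : tmulLeft a ≫ ofTensor w A ≫ toTensor w A = tmulLeft a := by
    refine hom_ext_single fun i => hom_ext fun r => ?_
    have h1 : (hom (ofTensor w A)).1 (tmul a ((hom (single i)).1 r)) =
        (hom (single i)).1 (scalar r • a) := by
      refine ext fun j => (coord_ofTensor_tmul A a _ j).trans ?_
      by_cases hj : j = i
      · subst hj
        rw [coord_single_self, coord_single_self]
      · rw [coord_single_of_ne hj, coord_single_of_ne hj]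
        exact zero_smul R a
    refine (congrArg (hom (toTensor w A)).1 h1).trans ((toTensor_single A i _).trans ?_)
    have h2 : (hom (single (w := w) i)).1 r = scalar r • basis w i := by
      refine Eq.trans ?_ ((hom (single (w := w) (A := unit R) i)).2 (scalar r)
        (show unit R from (1 : R)))
      exact congrArg (hom (single (w := w) (A := unit R) i)).1 (mul_one (scalar r)).symm
    refine Eq.trans ?_ (congrArg (tmul a) h2).symm
    exact (LinearMap.map_smul₂ (tmulBilin A (ell1 w (unit R))) (scalar r) a _).trans
      (map_smul (tmulBilin A (ell1 w (unit R)) a) (scalar r) (basis w i)).symm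
  exact congrArg (fun k => (hom k).1 x) key

/-- The isomorphism `ℓ¹(w, A) ≅ A ⊗̂ ℓ¹(w, R)`, natural in `A`. -/
def tensorIso (w : PosWeight ι) :
    ell1Functor R w ≅ (tensorFunctor R).flip.obj (ell1 w (unit R)) :=
  (NatIso.ofComponents
    (fun A => Iso.mk (ofTensor w A) (toTensor w A) (ofTensor_toTensor A) (toTensor_ofTensor A))
    fun {A B} f => tensor_hom_ext fun a x => ext fun i => by
      refine Eq.trans (congrArg (fun t => coord i ((hom (ofTensor w B)).1 t))
        (tensorMap_tmul f (𝟙 (ell1 w (unit R))) a x)) ?_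
      refine (coord_ofTensor_tmul B _ x i).trans ?_
      refine ((hom f).2 _ a).symm.trans ?_
      exact congrArg (hom f).1 (coord_ofTensor_tmul A a x i).symm).symm

instance preservesEqualizers_tensor : PreservesLimitsOfShape WalkingParallelPair
    ((tensorFunctor R).flip.obj (ell1 w (unit R))) :=
  preservesLimitsOfShape_of_natIso (tensorIso w)

/-- The bounded map that sends `T : W ⟶ ℓ¹(w, R)` to its coordinates in `ℓ¹(w', W^∨)`, if
`w' / w` is summable. -/
def dualCoord (W : BanMod R) {w w' : PosWeight ι} (h : Summable fun i => w'.1 i / w.1 i) :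
    ihom W (ell1 w (unit R)) ⟶ ell1 w' (dual W) :=
  let c (i : ι) : ell1 w (unit R) ⟶ unit R :=
    mkHom (coord i) ⟨_, fun x => norm_coord_le x i⟩
  lift (LinearMap.pi fun i => toLin ((ihomFunctor W).map (c i)))
    ⟨∑' i, w'.1 i / w.1 i, fun T s => by
      refine le_trans ?_ (mul_le_mul_of_nonneg_right
        (h.sum_le_tsum s fun i _ => (div_pos (w'.2 i) (w.2 i)).le) (norm_nonneg _))
      rw [Finset.sum_mul]
      refine Finset.sum_le_sum fun i _ => ?_
      rw [div_eq_mul_inv, mul_right_comm, mul_comm, mul_assoc]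
      refine mul_le_mul_of_nonneg_left ?_ (w'.2 i).le
      rw [mul_comm]
      refine linHom_norm_le (M := W) (N := unit R) _
        (mul_nonneg (inv_pos.2 (w.2 i)).le (norm_nonneg _)) fun m => ?_
      refine (norm_coord_le _ i).trans ?_
      rw [mul_assoc]
      exact mul_le_mul_of_nonneg_left
        (linHom_norm_apply_le (M := W) (N := ell1 w (unit R)) T m) (inv_pos.2 (w.2 i)).le⟩

lemma coord_dualCoord (W : BanMod R) {w w' : PosWeight ι} (h : Summable fun i => w'.1 i / w.1 i)
    (T : ihom W (ell1 w (unit R))) (i : ι) (m : W) :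
    dualApply (coord i ((hom (dualCoord W h)).1 T)) m =
      scalar (coord i ((show linHom W (ell1 w (unit R)) from T).1 m)) := rfl

/-- A partial inverse of `W^∨ ⊗̂ ℓ¹(w, R) ⟶ Hom(W, ℓ¹(w, R))`. -/
def ihomToTensor (W : BanMod R) {w w' : PosWeight ι} (h : Summable fun i => w'.1 i / w.1 i) :
    ihom W (ell1 w (unit R)) ⟶ tensor (dual W) (ell1 w' (unit R)) :=
  dualCoord W h ≫ toTensor w' (dual W)

lemma exists_le_of_summable {w w' : PosWeight ι} (h : Summable fun i => w'.1 i / w.1 i) :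
    ∃ C : ℝ, ∀ i, w'.1 i ≤ C * w.1 i :=
  ⟨∑' i, w'.1 i / w.1 i, fun i => (div_le_iff₀ (w.2 i)).1
    (h.le_tsum i fun j _ => (div_pos (w'.2 j) (w.2 j)).le)⟩

lemma coord_dualTensorHom (W : BanMod R) (t : tensor (dual W) (ell1 w (unit R))) (i : ι) (m : W) :
    scalar (coord i
      ((show linHom W (ell1 w (unit R)) from (hom (dualTensorHom W _)).1 t).1 m)) =
      dualApply (coord i ((hom (ofTensor w (dual W))).1 t)) m := by
  let p : ihom W (ell1 w (unit R)) ⟶ unit R :=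
    mkHom
      { toFun := fun T => coord i ((show linHom W (ell1 w (unit R)) from T).1 m)
        map_add' := fun T T' => rfl
        map_smul' := fun a T => rfl }
      ⟨(w.1 i)⁻¹ * ‖m‖, fun T => (norm_coord_le _ i).trans (by
        rw [mul_assoc, mul_comm ‖m‖]
        exact mul_le_mul_of_nonneg_left
          (linHom_norm_apply_le (M := W) (N := ell1 w (unit R)) T m) (inv_pos.2 (w.2 i)).le)⟩
  let q : ell1 w (dual W) ⟶ unit R :=
    mkHom
      { toFun := fun x => (show unit R from dualApply (coord i x) m)
        map_add' := fun T T' => rfl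
        map_smul' := fun a T => rfl }
      ⟨(w.1 i)⁻¹ * ‖m‖, fun x => (norm_dualApply_le _ m).trans (by
        rw [mul_right_comm]
        exact mul_le_mul_of_nonneg_right (norm_coord_le x i) (norm_nonneg m))⟩
  have key : dualTensorHom W (ell1 w (unit R)) ≫ p = ofTensor w (dual W) ≫ q := by
    refine tensor_hom_ext fun φ x => ?_
    refine (congrArg (hom p).1 (dualTensorHom_tmul W _ φ x)).trans ?_
    have h := congrArg (fun ψ : dual W => (show unit R from dualApply ψ m))
      (coord_ofTensor_tmul (dual W) φ x i)
    refine Eq.trans ?_ h.symm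
    exact mul_comm (dualApply φ m) (scalar (coord i x))
  exact congrArg (fun k => (hom k).1 t) key

lemma ihomToTensor_dualTensorHom (W : BanMod R) {w w' : PosWeight ι}
    (h : Summable fun i => w'.1 i / w.1 i) :
    ihomToTensor W h ≫ dualTensorHom W (ell1 w' (unit R)) =
      (ihomFunctor W).map (restrict (unit R) (exists_le_of_summable h)) := by
  refine hom_ext fun T => linHom_ext fun m => ext fun i => ?_
  refine (coord_dualTensorHom W _ i m).trans ?_
  have := congrArg (fun k => (hom k).1 ((hom (dualCoord W h)).1 T))
    (toTensor_ofTensor (w := w') (dual W))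
  refine (congrArg (fun x => dualApply (coord i x) m) this).trans ?_
  refine (coord_dualCoord W h T i m).trans ?_
  exact (coord_restrict (exists_le_of_summable h)
    ((show linHom W (ell1 w (unit R)) from T).1 m) i).symm

lemma dualTensorHom_ihomToTensor (W : BanMod R) {w w' : PosWeight ι}
    (h : Summable fun i => w'.1 i / w.1 i) :
    dualTensorHom W (ell1 w (unit R)) ≫ ihomToTensor W h =
      tensorMap (𝟙 _) (restrict (unit R) (exists_le_of_summable h)) := by
  have key : dualTensorHom W (ell1 w (unit R)) ≫ dualCoord W h =
      tensorMap (𝟙 _) (restrict (unit R) (exists_le_of_summable h)) ≫ ofTensor w' (dual W) := by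
    refine hom_ext' fun t i => linHom_ext (M := W) (N := unit R) fun m => ?_
    refine (coord_dualCoord W h ((hom (dualTensorHom W _)).1 t) i m).trans ?_
    refine (coord_dualTensorHom W t i m).trans ?_
    refine congrArg (fun ψ : dual W => dualApply ψ m) ?_
    have : ofTensor w (dual W) ≫ restrict (dual W) (exists_le_of_summable h) =
        tensorMap (𝟙 _) (restrict (unit R) (exists_le_of_summable h)) ≫ ofTensor w' (dual W) := by
      refine tensor_hom_ext fun φ x => ext fun j => ?_
      let x' : ell1 w' (unit R) := (hom (restrict (unit R) (exists_le_of_summable h))).1 x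
      have hx : coord j x' = coord j x := coord_restrict (exists_le_of_summable h) x j
      refine (coord_restrict (exists_le_of_summable h) _ j).trans ?_
      refine (coord_ofTensor_tmul (dual W) φ x j).trans ?_
      rw [← hx]
      refine Eq.trans ?_ (congrArg (fun y => coord j ((hom (ofTensor w' (dual W))).1 y))
        (tensorMap_tmul (𝟙 (dual W)) (restrict (unit R) (exists_le_of_summable h)) φ x)).symm
      exact (coord_ofTensor_tmul (dual W) φ x' j).symm
    refine (coord_restrict (exists_le_of_summable h)
      ((hom (ofTensor w (dual W))).1 t) i).symm.trans ?_
    exact congrArg (fun k => coord i ((hom k).1 t)) this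
  rw [ihomToTensor, ← Category.assoc, key, Category.assoc, ofTensor_toTensor, Category.comp_id]

end ell1

end Ell1

end BanMod

namespace IndExt

variable {C : Type u} [Category.{v} C]

section Limit

variable {I : Type v} [SmallCategory I] [IsFiltered I] {F : I ⥤ C}

lemma exists_factor {c : Cocone (F ⋙ Ind.yoneda)} (hc : IsColimit c) {W : C}
    (f : Ind.yoneda.obj W ⟶ c.pt) :
    ∃ (i : I) (l : W ⟶ F.obj i), Ind.yoneda.map l ≫ c.ι.app i = f := by
  have := (final_toArrow hc).out (CostructuredArrow.mk f)
  obtain ⟨g⟩ : Nonempty (StructuredArrow (CostructuredArrow.mk f) (toArrow c)) := inferInstance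
  exact ⟨g.right, g.hom.left, CostructuredArrow.w g.hom⟩

/-- A criterion for `"colim" F` to be the limit of a diagram of objects of `C`. -/
lemma nonempty_isLimit {J : Type*} [Category* J] [Nonempty J] {G : J ⥤ C}
    {c : Cocone (F ⋙ Ind.yoneda)} (hc : IsColimit c) (p : ∀ i j, F.obj i ⟶ G.obj j)
    (hp : ∀ i j, Mono (p i j)) (π : (Functor.const J).obj c.pt ⟶ G ⋙ Ind.yoneda)
    (hπ : ∀ i j, c.ι.app i ≫ π.app j = Ind.yoneda.map (p i j))
    (hs : ∀ s : Cone G, ∃ (i : I) (l : s.pt ⟶ F.obj i), ∀ j, l ≫ p i j = s.π.app j) :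
    Nonempty (IsLimit (Cone.mk c.pt π)) := by
  have hi : ∀ {W : C} {a b : Ind.yoneda.obj W ⟶ c.pt},
      (∀ j, a ≫ π.app j = b ≫ π.app j) → a = b := by
    intro W a b h
    obtain ⟨i, a, rfl⟩ := exists_factor hc a
    obtain ⟨i', b, rfl⟩ := exists_factor hc b
    obtain ⟨k, f, f', -⟩ := IsFilteredOrEmpty.cocone_objs i i'
    obtain ⟨j⟩ := ‹Nonempty J›
    have hw : ∀ {i : I} (f : i ⟶ k) (a : W ⟶ F.obj i), Ind.yoneda.map a ≫ c.ι.app i =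
        Ind.yoneda.map (a ≫ F.map f) ≫ c.ι.app k := fun f a => by
      rw [Functor.map_comp, Category.assoc]
      exact congrArg (_ ≫ ·) (c.w f).symm
    rw [hw f a, hw f' b] at h ⊢
    have h' := h j
    rw [Category.assoc, Category.assoc, hπ, ← Functor.map_comp, ← Functor.map_comp] at h'
    rw [(cancel_mono (p k j)).1 (Ind.yoneda.map_injective h')]
  have he : ∀ (W : C) (s : (Functor.const J).obj (Ind.yoneda.obj W) ⟶ G ⋙ Ind.yoneda),
      ∃ l : Ind.yoneda.obj W ⟶ c.pt, ∀ j, l ≫ π.app j = s.app j := by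
    intro W s
    obtain ⟨i, l, hl⟩ := hs
      { pt := W
        π :=
          { app := fun j => Ind.yoneda.preimage (s.app j)
            naturality := fun j j' f => Ind.yoneda.map_injective (by
              have := s.naturality f
              simpa using this) } }
    refine ⟨Ind.yoneda.map l ≫ c.ι.app i, fun j => ?_⟩
    rw [Category.assoc, hπ, ← Functor.map_comp, hl j]
    exact Ind.yoneda.map_preimage _
  have hX : ∀ X : Ind C, ∃ (K : Type v) (_ : SmallCategory K) (F' : K ⥤ C)
      (ι : F' ⋙ Ind.yoneda ⟶ (Functor.const K).obj X), Nonempty (IsColimit (Cocone.mk X ι)) :=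
    fun X => ⟨_, inferInstance, X.presentation.F,
      _, ⟨(colimit.isColimit _).extendIso X.colimitPresentationCompYoneda.hom⟩⟩
  have hl : ∀ s : Cone (G ⋙ Ind.yoneda), ∃ l : s.pt ⟶ c.pt, ∀ j, l ≫ π.app j = s.π.app j := by
    intro s
    obtain ⟨K, _, F', ι, ⟨hι⟩⟩ := hX s.pt
    choose l hl using fun k => he (F'.obj k) ((Functor.const J).map (ι.app k) ≫ s.π)
    refine ⟨hι.desc (Cocone.mk c.pt
      { app := l
        naturality := fun k k' f => hi fun j => ?_ }), fun j => hι.hom_ext fun k => ?_⟩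
    · have h1 := hl k j
      have h2 := hl k' j
      have h3 := ι.naturality f
      simp only [NatTrans.comp_app, Functor.const_map_app, Functor.const_obj_obj,
        Functor.const_obj_map, Category.comp_id] at h1 h2 h3 ⊢
      rw [Category.assoc, h2, h1, ← h3, Category.assoc]
    · rw [hι.fac_assoc]
      exact hl k j
  choose l hl using hl
  refine ⟨⟨l, fun s j => hl s j, fun s m hm => ?_⟩⟩
  obtain ⟨K, _, F', ι, ⟨hι⟩⟩ := hX s.pt
  refine hι.hom_ext fun k => hi fun j => ?_
  have h1 : m ≫ π.app j = s.π.app j := hm j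
  rw [Category.assoc, Category.assoc, h1]
  exact congrArg (_ ≫ ·) (hl s j).symm

end Limit

end IndExt

/-! ### Weights -/

section Weights

variable {n : ℕ}

/-- The summable family `∏ (Jᵢ + 1)⁻²`. -/
def invSq (J : Fin n →₀ ℕ) : ℝ := ∏ i, (((J i : ℝ) + 1) ^ 2)⁻¹

lemma invSq_pos (J : Fin n →₀ ℕ) : 0 < invSq J :=
  Finset.prod_pos fun _ _ => by positivity

lemma summable_invSq : Summable (invSq : (Fin n →₀ ℕ) → ℝ) := by
  have h0 : Summable fun m : ℕ => (((m : ℝ) + 1) ^ 2)⁻¹ := by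
    have := (summable_nat_add_iff 1).2 (Real.summable_nat_pow_inv (p := 2) |>.2 one_lt_two)
    simpa using this
  refine summable_of_sum_le (c := ∏ _i : Fin n, ∑' m : ℕ, (((m : ℝ) + 1) ^ 2)⁻¹)
    (fun J => (invSq_pos J).le) fun s => ?_
  let N : Finset ℕ := s.biUnion fun J => Finset.univ.image J
  calc ∑ J ∈ s, invSq J = ∑ p ∈ s.image (fun J : Fin n →₀ ℕ => (J : Fin n → ℕ)),
        ∏ i, (((p i : ℝ) + 1) ^ 2)⁻¹ := by
        rw [Finset.sum_image fun _ _ _ _ h => DFunLike.coe_injective h]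
        rfl
    _ ≤ ∑ p ∈ Fintype.piFinset fun _ : Fin n => N, ∏ i, (((p i : ℝ) + 1) ^ 2)⁻¹ := by
        refine Finset.sum_le_sum_of_subset_of_nonneg (fun p hp => ?_)
          fun p _ _ => Finset.prod_nonneg fun _ _ => by positivity
        obtain ⟨J, hJ, rfl⟩ := Finset.mem_image.1 hp
        exact Fintype.mem_piFinset.2 fun i =>
          Finset.mem_biUnion.2 ⟨J, hJ, Finset.mem_image_of_mem _ (Finset.mem_univ i)⟩
    _ = ∏ _i : Fin n, ∑ m ∈ N, (((m : ℝ) + 1) ^ 2)⁻¹ :=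
        (Finset.prod_univ_sum (fun _ : Fin n => N) fun _ m => (((m : ℝ) + 1) ^ 2)⁻¹).symm
    _ ≤ _ := Finset.prod_le_prod (fun _ _ => Finset.sum_nonneg fun _ _ => by positivity)
        fun _ _ => h0.sum_le_tsum N fun _ _ => by positivity

lemma exists_pow_le_inv_sq_mul {a b : ℝ} (ha : 0 < a) (hab : a < b) :
    ∃ K : ℝ, 0 ≤ K ∧ ∀ m : ℕ, a ^ m ≤ K * ((((m : ℝ) + 1) ^ 2)⁻¹ * b ^ m) := by
  have hb := ha.trans hab
  have hr : |a / b| < 1 := by rwa [abs_of_pos (div_pos ha hb), div_lt_one hb]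
  obtain ⟨K, hK⟩ := (tendsto_pow_const_mul_const_pow_of_abs_lt_one 2 hr).bddAbove_range
  have hK' : ∀ m : ℕ, ((m : ℝ) + 1) ^ 2 * (a / b) ^ (m + 1) ≤ K := fun m => by
    have := hK ⟨m + 1, rfl⟩
    simpa using this
  refine ⟨K * (b / a), mul_nonneg ((by positivity : (0 : ℝ) ≤ _).trans (hK' 0)) (by positivity),
    fun m => ?_⟩
  have h1 : a ^ m = ((m : ℝ) + 1) ^ 2 * (a / b) ^ (m + 1) *
      (b / a * ((((m : ℝ) + 1) ^ 2)⁻¹ * b ^ m)) := by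
    rw [div_pow]
    field_simp
    ring
  rw [h1, mul_assoc K]
  exact mul_le_mul_of_nonneg_right (hK' m) (by positivity)

lemma PolyRadius.exists_pow_le_invSq_mul {ρ τ : PolyRadius n} (h : ∀ i, ρ.1 i < τ.1 i) :
    ∃ K : ℝ, 0 ≤ K ∧ ∀ J, ρ.pow J ≤ K * (invSq J * τ.pow J) := by
  choose K hK hK' using fun i => exists_pow_le_inv_sq_mul (ρ.2 i) (h i)
  refine ⟨∏ i, K i, Finset.prod_nonneg fun i _ => hK i, fun J => ?_⟩
  rw [invSq, PolyRadius.pow, PolyRadius.pow, ← Finset.prod_mul_distrib, ← Finset.prod_mul_distrib]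
  exact Finset.prod_le_prod (fun i _ => (_root_.pow_pos (ρ.2 i) _).le) fun i _ => hK' i _

/-- The weights that dominate the monomials of all radii in a family; a smaller weight counts as
later. -/
structure DominatingWeight {κ : Type} (rad : κ → PolyRadius n) : Type u where
  weight : BanMod.PosWeight (Fin n →₀ ℕ)
  exists_pow_le : ∀ k, ∃ C : ℝ, ∀ J, (rad k).pow J ≤ C * weight.1 J

/-- A countable cofinal sequence of indices such that the radii increase strictly. -/
def IsExhausting {κ : Type} [Preorder κ] (rad : κ → PolyRadius n) (s : ℕ → κ) : Prop :=
  Monotone s ∧ ∀ k, ∃ m, k ≤ s m ∧ ∀ i, (rad k).1 i < (rad (s m)).1 i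

namespace DominatingWeight

variable {κ : Type} {rad : κ → PolyRadius n}

instance : Preorder (DominatingWeight.{u} rad) where
  le w w' := ∃ C : ℝ, ∀ J, w'.weight.1 J ≤ C * w.weight.1 J
  le_refl w := ⟨1, fun J => (one_mul _).ge⟩
  le_trans w₁ w₂ w₃ := by
    rintro ⟨C, h⟩ ⟨C', h'⟩
    refine ⟨max C' 0 * C, fun J => (h' J).trans ?_⟩
    rw [mul_assoc]
    refine (mul_le_mul_of_nonneg_right (le_max_left C' 0) (w₂.weight.2 J).le).trans ?_
    exact mul_le_mul_of_nonneg_left (h J) (le_max_right _ _)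

instance : IsDirected (DominatingWeight.{u} rad) (· ≤ ·) where
  directed w w' := by
    refine ⟨⟨⟨fun J => min (w.weight.1 J) (w'.weight.1 J),
      fun J => lt_min (w.weight.2 J) (w'.weight.2 J)⟩, fun k => ?_⟩,
      ⟨1, fun J => (min_le_left _ _).trans_eq (one_mul _).symm⟩,
      ⟨1, fun J => (min_le_right _ _).trans_eq (one_mul _).symm⟩⟩
    obtain ⟨C, h⟩ := w.exists_pow_le k
    obtain ⟨C', h'⟩ := w'.exists_pow_le k
    refine ⟨max C C', fun J => ?_⟩
    dsimp only
    rcases min_choice (w.weight.1 J) (w'.weight.1 J) with e | e <;> rw [e]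
    · exact (h J).trans (mul_le_mul_of_nonneg_right (le_max_left _ _) (w.weight.2 J).le)
    · exact (h' J).trans (mul_le_mul_of_nonneg_right (le_max_right _ _) (w'.weight.2 J).le)

/-- The product of a weight with a summable family. -/
def shrink [Preorder κ] {s : ℕ → κ} (hs : IsExhausting rad s) (w : DominatingWeight.{u} rad) :
    DominatingWeight.{u} rad where
  weight := ⟨fun J => invSq J * w.weight.1 J, fun J => mul_pos (invSq_pos J) (w.weight.2 J)⟩
  exists_pow_le k := by
    obtain ⟨m, -, hm⟩ := hs.2 k
    obtain ⟨K, hK, h⟩ := PolyRadius.exists_pow_le_invSq_mul hm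
    obtain ⟨C, hC⟩ := w.exists_pow_le (s m)
    refine ⟨K * C, fun J => (h J).trans ?_⟩
    rw [mul_assoc, mul_left_comm C]
    exact mul_le_mul_of_nonneg_left (mul_le_mul_of_nonneg_left (hC J) (invSq_pos J).le) hK

lemma shrink_weight [Preorder κ] {s : ℕ → κ} (hs : IsExhausting rad s)
    (w : DominatingWeight.{u} rad) (J : Fin n →₀ ℕ) :
    (shrink hs w).weight.1 J = invSq J * w.weight.1 J := rfl

lemma summable_shrink_div [Preorder κ] {s : ℕ → κ} (hs : IsExhausting rad s)
    (w : DominatingWeight.{u} rad) :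
    Summable fun J => (shrink hs w).weight.1 J / w.weight.1 J := by
  refine summable_invSq.congr fun J => ?_
  exact (mul_div_cancel_right₀ _ (w.weight.2 J).ne').symm

lemma exists_sum_mul_weight_le [Preorder κ] {s : ℕ → κ} (hs : IsExhausting rad s) (φ : ℕ → ℝ)
    (hφ : ∀ k, 0 < φ k) : ∃ w : DominatingWeight.{u} rad, ∀ (a : (Fin n →₀ ℕ) → ℝ) (B : ℝ),
      (∀ J, 0 ≤ a J) → 0 ≤ B → (∀ k J, a J * (rad (s k)).pow J ≤ φ k * B) →
      ∀ S : Finset (Fin n →₀ ℕ), ∑ J ∈ S, a J * w.weight.1 J ≤ (∑' J, invSq (n := n) J) * B := by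
  let e : (Fin n →₀ ℕ) → ℕ := Encodable.encode
  let t (J : Fin n →₀ ℕ) (k : ℕ) : ℝ := (rad (s k)).pow J / φ k
  have ht : ∀ J k, 0 < t J k := fun J k => div_pos (PolyRadius.pow_pos _ J) (hφ k)
  let v (J : Fin n →₀ ℕ) : ℝ := (Finset.range (e J + 1)).sup' ⟨0, by simp⟩ (t J)
  have hv : ∀ J, ∃ k, v J = t J k := fun J => by
    obtain ⟨k, -, hk⟩ := Finset.exists_mem_eq_sup' (s := Finset.range (e J + 1)) ⟨0, by simp⟩ (t J)
    exact ⟨k, hk⟩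
  have hv0 : ∀ J, 0 < v J := fun J => by
    obtain ⟨k, hk⟩ := hv J
    rw [hk]
    exact ht J k
  let w₀ : DominatingWeight.{u} rad := ⟨⟨v, hv0⟩, fun k => by
    obtain ⟨m, -, hm⟩ := hs.2 k
    have hfin : {J : Fin n →₀ ℕ | e J < m}.Finite :=
      (Set.finite_lt_nat m).preimage (Encodable.encode_injective.injOn)
    obtain ⟨C, hC⟩ := (hfin.image fun J => (rad (s m)).pow J / v J).bddAbove
    refine ⟨max C (φ m), fun J => ?_⟩
    refine (PolyRadius.pow_le_pow (fun i => (hm i).le) J).trans ?_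
    dsimp only
    by_cases hJ : e J < m
    · have : (rad (s m)).pow J / v J ≤ C := hC ⟨J, hJ, rfl⟩
      rw [div_le_iff₀ (hv0 J)] at this
      exact this.trans (mul_le_mul_of_nonneg_right (le_max_left _ _) (hv0 J).le)
    · have h1 : t J m ≤ v J := Finset.le_sup' (t J) (Finset.mem_range.2 (by omega))
      rw [div_le_iff₀' (hφ m)] at h1
      exact h1.trans (mul_le_mul_of_nonneg_right (le_max_right _ _) (hv0 J).le)⟩
  refine ⟨shrink hs w₀, fun a B ha hB h S => ?_⟩
  have h1 : ∀ J ∈ S, a J * (shrink hs w₀).weight.1 J ≤ invSq J * B := fun J _ => by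
    have h2 : a J * v J ≤ B := by
      obtain ⟨k, hk⟩ := hv J
      rw [hk, ← mul_div_assoc, div_le_iff₀' (hφ k)]
      exact h k J
    rw [shrink_weight, mul_left_comm]
    exact mul_le_mul_of_nonneg_left h2 (invSq_pos J).le
  refine (Finset.sum_le_sum h1).trans ?_
  rw [← Finset.sum_mul]
  exact mul_le_mul_of_nonneg_right
    (summable_invSq.sum_le_tsum S fun J _ => (invSq_pos J).le) hB

lemma isFiltered [Preorder κ] {s : ℕ → κ} (hs : IsExhausting rad s) :
    IsFiltered (DominatingWeight.{u} rad) :=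
  have : Nonempty (DominatingWeight.{u} rad) :=
    ⟨(exists_sum_mul_weight_le hs (fun _ => 1) fun _ => one_pos).choose⟩
  inferInstance

/-- The system of the modules `ℓ¹(w, R)` of all dominating weights. -/
def functor (R : Type u) [BanachRing R] (rad : κ → PolyRadius n) :
    DominatingWeight.{u} rad ⥤ BanMod R where
  obj w := BanMod.ell1 w.weight (BanMod.unit R)
  map f := BanMod.ell1.restrict (BanMod.unit R) (leOfHom f)
  map_id w := BanMod.ell1.hom_ext' fun x J => BanMod.ell1.coord_restrict (le_refl w) x J
  map_comp {w w' w''} f g := BanMod.ell1.hom_ext' fun x J => by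
    let y : BanMod.ell1 w'.weight (BanMod.unit R) :=
      (BanMod.hom (BanMod.ell1.restrict (BanMod.unit R) (leOfHom f))).1 x
    have h₁ : BanMod.ell1.coord J y = BanMod.ell1.coord J x :=
      BanMod.ell1.coord_restrict (leOfHom f) x J
    have h₂ := BanMod.ell1.coord_restrict (leOfHom g) y J
    exact (BanMod.ell1.coord_restrict (leOfHom (f ≫ g)) x J).trans (h₂.trans h₁).symm

end DominatingWeight

end Weights

namespace DominatingWeight

open BanMod

variable {R : Type u} [BanachRing R] {n : ℕ} {κ : Type} {rad : κ → PolyRadius n}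

lemma summable_norm_mul_pow (w : DominatingWeight.{u} rad) (k : κ)
    (x : ell1 w.weight (unit R)) :
    Summable fun J => ‖ell1.scalar (ell1.coord J x)‖ * (rad k).pow J := by
  obtain ⟨C, h⟩ := w.exists_pow_le k
  refine Summable.of_nonneg_of_le (fun J => mul_nonneg (norm_nonneg _) ((rad k).pow_pos J).le)
    (fun J => ?_) ((ell1.summable x).mul_left C)
  rw [mul_left_comm]
  exact mul_le_mul_of_nonneg_left (h J) (norm_nonneg _)

/-- The power series with coefficients in `ℓ¹(w, R)`, for a dominated radius. -/
def toDiskLin (w : DominatingWeight.{u} rad) (k : κ) :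
    ell1 w.weight (unit R) →ₗ[R] Disk.Carrier R (rad k) where
  toFun x := Disk.mk (fun J => ell1.scalar (ell1.coord J x)) (summable_norm_mul_pow w k x)
  map_add' x y := Disk.ext fun J => by
    rw [map_add, Disk.coeff_mk, Disk.coeff_mk, Disk.coeff_mk, map_add]
    rfl
  map_smul' a x := Disk.ext fun J => by
    rw [RingHom.id_apply, map_smul, Disk.coeff_mk, Disk.coeff_mk, map_smul]
    rfl

lemma coeff_toDiskLin (w : DominatingWeight.{u} rad) (k : κ) (x : ell1 w.weight (unit R))
    (J : Fin n →₀ ℕ) : Disk.coeff J (toDiskLin w k x) = ell1.scalar (ell1.coord J x) :=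
  Disk.coeff_mk (fun J => ell1.scalar (ell1.coord J x)) (summable_norm_mul_pow w k x) J

lemma exists_norm_toDiskLin_le (w : DominatingWeight.{u} rad) (k : κ) :
    ∃ C : ℝ, ∀ x : ell1 w.weight (unit R), ‖toDiskLin w k x‖ ≤ C * ‖x‖ := by
  obtain ⟨C, h⟩ := w.exists_pow_le k
  refine ⟨C, fun x => ?_⟩
  rw [ell1.norm_def, ← tsum_mul_left, Disk.norm_def]
  refine (Disk.summable (toDiskLin w k x)).tsum_le_tsum (fun J => ?_)
    ((ell1.summable x).mul_left C)
  rw [mul_left_comm, coeff_toDiskLin]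
  exact mul_le_mul_of_nonneg_left (h J) (norm_nonneg _)

/-- The inclusion of `ℓ¹(w, R)` in the polydisk algebra of a dominated radius. -/
def toDisk (R : Type u) [BanachRing R] (w : DominatingWeight.{u} rad) (k : κ) :
    ell1 w.weight (unit R) ⟶ diskAlgebra R (rad k) :=
  mkHom (M := ell1 w.weight (unit R)) (N := diskAlgebra R (rad k)) (toDiskLin w k)
    (exists_norm_toDiskLin_le w k)

/-- The coefficient of `x^J` of an element of a polydisk algebra. -/
def diskCoeff (ρ : PolyRadius n) (J : Fin n →₀ ℕ) : diskAlgebra R ρ →ₗ[R] unit R := Disk.coeff J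

lemma diskCoeff_ext {ρ : PolyRadius n} {f g : diskAlgebra R ρ}
    (h : ∀ J, diskCoeff ρ J f = diskCoeff ρ J g) : f = g := Disk.ext h

lemma norm_diskCoeff_mul_le {ρ : PolyRadius n} (f : diskAlgebra R ρ) (J : Fin n →₀ ℕ) :
    ‖diskCoeff ρ J f‖ * ρ.pow J ≤ ‖f‖ := Disk.norm_coeff_mul_le f J

lemma diskCoeff_restrict {ρ τ : PolyRadius n} (h : ρ ≤ τ) (f : diskAlgebra R τ)
    (J : Fin n →₀ ℕ) : diskCoeff ρ J ((hom (diskRestrict R h)).1 f) = diskCoeff τ J f :=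
  Disk.coeff_restrict h f J

lemma diskCoeff_toDisk (w : DominatingWeight.{u} rad) (k : κ) (x : ell1 w.weight (unit R))
    (J : Fin n →₀ ℕ) : diskCoeff (rad k) J ((hom (toDisk R w k)).1 x) = ell1.coord J x :=
  coeff_toDiskLin w k x J

lemma restrict_toDisk {w w' : DominatingWeight.{u} rad} (h : w ≤ w') (k : κ) :
    ell1.restrict (unit R) h ≫ toDisk R w' k = toDisk R w k :=
  hom_ext fun x => diskCoeff_ext fun J =>
    (diskCoeff_toDisk w' k ((hom (ell1.restrict (unit R) h)).1 x) J).trans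
      ((ell1.coord_restrict h x J).trans (diskCoeff_toDisk w k x J).symm)

lemma toDisk_restrict (w : DominatingWeight.{u} rad) {k k' : κ} (h : rad k ≤ rad k') :
    toDisk R w k' ≫ diskRestrict R h = toDisk R w k :=
  hom_ext fun x => diskCoeff_ext fun J =>
    (diskCoeff_restrict h ((hom (toDisk R w k')).1 x) J).trans
      ((diskCoeff_toDisk w k' x J).trans (diskCoeff_toDisk w k x J).symm)

lemma mono_toDisk (w : DominatingWeight.{u} rad) (k : κ) : Mono (toDisk R w k) where
  right_cancellation {Z} f g h := by
    refine ell1.hom_ext' fun m J => ?_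
    have := congrArg (fun l : Z ⟶ diskAlgebra R (rad k) => diskCoeff (rad k) J ((hom l).1 m)) h
    exact (diskCoeff_toDisk w k _ J).symm.trans (this.trans (diskCoeff_toDisk w k _ J))

variable [Preorder κ]

/-- The system of the polydisk algebras of a family of radii. -/
abbrev diskSystem (R : Type u) [BanachRing R] (hrad : Monotone rad) : κᵒᵖ ⥤ BanMod R :=
  hrad.functor.op ⋙ diskFunctor R n

variable (hrad : Monotone rad)

lemma exists_lift {s : ℕ → κ} (hs : IsExhausting rad s) (c : Cone (diskSystem R hrad)) :
    ∃ (w : DominatingWeight.{u} rad) (l : c.pt ⟶ (functor R rad).obj w),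
      ∀ k, l ≫ toDisk R w k.unop = c.π.app k := by
  let f (k : κ) : c.pt ⟶ diskAlgebra R (rad k) := c.π.app (Opposite.op k)
  have hf : ∀ {k k' : κ}, k ≤ k' → ∀ m J, diskCoeff (rad k') J ((hom (f k')).1 m) =
      diskCoeff (rad k) J ((hom (f k)).1 m) := fun {k k'} h m J => by
    have e : f k' ≫ diskRestrict R (hrad h) = f k := c.w (homOfLE h).op
    rw [← e]
    exact (diskCoeff_restrict (hrad h) _ J).symm
  have hf' : ∀ k m J, diskCoeff (rad (s 0)) J ((hom (f (s 0))).1 m) =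
      diskCoeff (rad k) J ((hom (f k)).1 m) := by
    intro k m J
    obtain ⟨i, hi, -⟩ := hs.2 k
    rw [← hf hi, hf (hs.1 (Nat.zero_le i))]
  obtain ⟨w, hw⟩ := exists_sum_mul_weight_le.{u} hs (fun k => ‖(hom (f (s k))).1‖ + 1)
    fun k => by positivity
  have hb : ∀ m (S : Finset (Fin n →₀ ℕ)),
      ∑ J ∈ S, ‖diskCoeff (rad (s 0)) J ((hom (f (s 0))).1 m)‖ * w.weight.1 J ≤
        (∑' J, invSq (n := n) J) * ‖m‖ := fun m S =>
    hw (fun J => ‖diskCoeff (rad (s 0)) J ((hom (f (s 0))).1 m)‖) ‖m‖ (fun J => norm_nonneg _)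
      (norm_nonneg _) (fun k J => by
        rw [hf' (s k) m J]
        refine (norm_diskCoeff_mul_le _ J).trans (((hom (f (s k))).1.le_opNorm m).trans ?_)
        exact mul_le_mul_of_nonneg_right (le_add_of_nonneg_right zero_le_one) (norm_nonneg m)) S
  let l : c.pt ⟶ ell1 w.weight (unit R) := ell1.lift
    (LinearMap.pi fun J => (diskCoeff (rad (s 0)) J).comp (toLin (f (s 0)))) ⟨_, hb⟩
  have hl : ∀ m J, ell1.coord J ((hom l).1 m) = diskCoeff (rad (s 0)) J ((hom (f (s 0))).1 m) :=
    fun m J => ell1.coord_lift _ _ m J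
  exact ⟨w, l, fun k => hom_ext fun m => diskCoeff_ext fun J =>
    (diskCoeff_toDisk w k.unop _ J).trans ((hl m J).trans (hf' k.unop m J))⟩

/-- The projections from `"colim" ℓ¹(w, R)` to the polydisk algebras. -/
def toSystem {c : Cocone (functor R rad ⋙ Ind.yoneda)} (hc : IsColimit c) :
    (Functor.const κᵒᵖ).obj c.pt ⟶ diskSystem R hrad ⋙ Ind.yoneda where
  app k := hc.desc (Cocone.mk (Ind.yoneda.obj (diskAlgebra R (rad k.unop)))
    { app := fun w => Ind.yoneda.map (toDisk R w k.unop)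
      naturality := fun w w' f => by
        refine ((Ind.yoneda.map_comp _ _).symm.trans ?_).trans (Category.comp_id _).symm
        exact congrArg Ind.yoneda.map (restrict_toDisk (leOfHom f) k.unop) })
  naturality k k' f := hc.hom_ext fun w => by
    refine Eq.trans (congrArg (c.ι.app w ≫ ·) (Category.id_comp _)) ?_
    refine (hc.fac _ w).trans ?_
    refine Eq.trans ?_ (Category.assoc _ _ _)
    refine Eq.trans ?_ (congrArg (· ≫ Ind.yoneda.map (diskRestrict R (hrad (leOfHom f.unop))))
      (hc.fac _ w)).symm
    refine Eq.trans ?_ (Ind.yoneda.map_comp _ _)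
    exact congrArg Ind.yoneda.map (toDisk_restrict w (hrad (leOfHom f.unop))).symm

lemma ι_toSystem {c : Cocone (functor R rad ⋙ Ind.yoneda)} (hc : IsColimit c)
    (w : DominatingWeight.{u} rad) (k : κᵒᵖ) :
    c.ι.app w ≫ (toSystem hrad hc).app k = Ind.yoneda.map (toDisk R w k.unop) := hc.fac _ w

/-- The limit of the polydisk algebras of an exhausting family of radii is `"colim" ℓ¹(w, R)` for
the dominating weights `w`. -/
theorem nonempty_isLimit_toSystem {s : ℕ → κ} (hs : IsExhausting rad s)
    {c : Cocone (functor R rad ⋙ Ind.yoneda)} (hc : IsColimit c) :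
    Nonempty (IsLimit (Cone.mk c.pt (toSystem hrad hc))) :=
  have := isFiltered.{u} hs
  have : Nonempty κᵒᵖ := ⟨Opposite.op (s 0)⟩
  IndExt.nonempty_isLimit (G := diskSystem R hrad) hc (fun w k => toDisk R w k.unop)
    (fun w k => mono_toDisk w k.unop)
    (toSystem hrad hc) (ι_toSystem hrad hc) (exists_lift hrad hs)

/-- `"colim" ℓ¹(w, R)` is nuclear. -/
theorem isNuclear {s : ℕ → κ} (hs : IsExhausting rad s)
    {c : Cocone (functor R rad ⋙ Ind.yoneda)} (hc : IsColimit c) : IndBan.IsNuclear c.pt :=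
  have := isFiltered.{u} hs
  IndBan.isNuclear_of_isColimit hc (shrink hs)
    (fun w => homOfLE (ell1.exists_le_of_summable (summable_shrink_div hs w)))
    (fun W w => ell1.ihomToTensor W (summable_shrink_div hs w))
    (fun W w => ell1.ihomToTensor_dualTensorHom W (summable_shrink_div hs w))
    (fun W w => ell1.dualTensorHom_ihomToTensor W (summable_shrink_div hs w))

/-- `"colim" ℓ¹(w, R)` is flat. -/
theorem isFlat {s : ℕ → κ} (hs : IsExhausting rad s)
    {c : Cocone (functor R rad ⋙ Ind.yoneda)} (hc : IsColimit c) : IndBan.IsFlat c.pt :=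
  have := isFiltered.{u} hs
  IndBan.isFlat_of_isColimit hc fun _ => ell1.preservesEqualizers_tensor

/-- The limit of the polydisk algebras of an exhausting family of radii exists and is nuclear and
flat. -/
theorem hasLimit_and_isNuclear_and_isFlat {s : ℕ → κ} (hs : IsExhausting rad s) :
    HasLimit (diskSystem R hrad ⋙ Ind.yoneda) ∧
      ∀ 𝒪 : Cone (diskSystem R hrad ⋙ Ind.yoneda), IsLimit 𝒪 →
        IndBan.IsNuclear 𝒪.pt ∧ IndBan.IsFlat 𝒪.pt := by
  have := isFiltered.{u} hs
  have hc := colimit.isColimit (functor R rad ⋙ Ind.yoneda)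
  obtain ⟨hl⟩ := nonempty_isLimit_toSystem hrad hs hc
  refine ⟨⟨⟨⟨_, hl⟩⟩⟩, fun 𝒪 h𝒪 => ?_⟩
  have hc' := hc.extendIso (hl.conePointUniqueUpToIso h𝒪).hom
  have h₁ := isNuclear hs hc'
  have h₂ := isFlat hs hc'
  exact ⟨h₁, h₂⟩

end DominatingWeight

section Exhausting

variable {n : ℕ}

lemma isExhausting_constRadius : IsExhausting (constRadius n) Nat.succPNat :=
  ⟨Nat.succPNat_strictMono.monotone, fun k => ⟨k, by
    rw [← PNat.coe_le_coe]; exact Nat.le_succ _, fun _ =>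
    Nat.cast_lt.2 (Nat.lt_succ_self (k : ℕ))⟩⟩

/-- The radius `1 / (r + 1 / (m + 1))`, which increases to `1 / r`. -/
def radiusBelow (r : Fin n → ℝ≥0) (m : ℕ) : RadiiBelow fun i => (r i : ℝ≥0∞)⁻¹ :=
  ⟨⟨fun i => ((r i : ℝ) + 1 / ((m : ℝ) + 1))⁻¹, fun i => by positivity⟩, fun i => by
    have h : (0 : ℝ) < r i + 1 / ((m : ℝ) + 1) := by positivity
    rw [ENNReal.ofReal_inv_of_pos h, ENNReal.inv_lt_inv, ← ENNReal.ofReal_coe_nnreal,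
      ENNReal.ofReal_lt_ofReal_iff h]
    exact lt_add_of_pos_right _ (by positivity)⟩

lemma isExhausting_radiusBelow (r : Fin n → ℝ≥0) :
    IsExhausting (fun ρ : RadiiBelow fun i => (r i : ℝ≥0∞)⁻¹ => ρ.1) (radiusBelow r) := by
  have hmono : ∀ {a b : ℕ}, a ≤ b → ∀ i, (radiusBelow r a).1.1 i ≤ (radiusBelow r b).1.1 i :=
    fun h i => inv_anti₀ (by positivity)
      (add_le_add_right (one_div_le_one_div_of_le (by positivity) (by exact_mod_cast by omega)) _)
  refine ⟨fun a b h i => hmono h i, fun ρ => ?_⟩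
  have hρ : ∀ i, ∃ m : ℕ, ρ.1.1 i < (radiusBelow r m).1.1 i := fun i => by
    have h1 := ρ.2 i
    have h2 : (r i : ℝ) < (ρ.1.1 i)⁻¹ := by
      rw [ENNReal.lt_inv_iff_lt_inv, ← ENNReal.ofReal_inv_of_pos (ρ.1.2 i),
        ← ENNReal.ofReal_coe_nnreal, ENNReal.ofReal_lt_ofReal_iff (inv_pos.2 (ρ.1.2 i))] at h1
      exact h1
    obtain ⟨m, hm⟩ := exists_nat_one_div_lt (sub_pos.2 h2)
    refine ⟨m, (lt_inv_comm₀ (ρ.1.2 i) (by positivity)).2 ?_⟩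
    linarith
  choose m hm using hρ
  have hlt : ∀ i, ρ.1.1 i < (radiusBelow r (Finset.univ.sup m)).1.1 i := fun i =>
    (hm i).trans_le (hmono (Finset.le_sup (Finset.mem_univ i)) i)
  exact ⟨Finset.univ.sup m, fun i => (hlt i).le, hlt⟩

end Exhausting

end

theorem mainTheorem6 (R : Type u) [BanachRing R] (n : ℕ) :
    (∀ r : Fin n → ℝ≥0,
      HasLimit (openDiskSystem R fun i => (r i : ℝ≥0∞)⁻¹) ∧
      ∀ 𝒪 : Cone (openDiskSystem R fun i => (r i : ℝ≥0∞)⁻¹), IsLimit 𝒪 →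
        IndBan.IsNuclear 𝒪.pt ∧ IndBan.IsFlat 𝒪.pt) ∧
    (HasLimit (affineSpaceSystem R n) ∧
      ∀ 𝒪 : Cone (affineSpaceSystem R n), IsLimit 𝒪 →
        IndBan.IsNuclear 𝒪.pt ∧ IndBan.IsFlat 𝒪.pt) :=
  ⟨fun r => DominatingWeight.hasLimit_and_isNuclear_and_isFlat (Subtype.mono_coe _)
    (isExhausting_radiusBelow r),
   DominatingWeight.hasLimit_and_isNuclear_and_isFlat (constRadius_mono n)
    isExhausting_constRadius⟩
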